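/- Let $S^1=\mathbb R/\mathbb Z$, let $C^1(S^1,\mathbb R^2)$ be the Banach space of continuously differentiable maps with the $C^1$ norm, and let \[ \mathrm{Imm}^1=\{\gamma\in C^1(S^1,\mathbb R^2): \gamma'(u)\neq 0 \text{ for all } u\in S^1\}, \] an open subset of $C^1(S^1,\mathbb R^2)$ with the induced topology. For $\gamma\in\mathrm{Imm}^1$ and $v,w\in T_\gamma\mathrm{Imm}^1=C^1(S^1,\mathbb R^2)$ let \[ \langle v,w\rangle_{\gamma,L^2(ds)}=\int_{S^1}\langle v(u),w(u)\rangle\,|\gamma'(u)|\,du,\qquad \|v\|_{\gamma,L^2(ds)}=\langle v,v\rangle_{\gamma,L^2(ds)}^{1/2}. \] A piecewise smooth path in $\mathrm{Imm}^1$ is a continuous map $\alpha:[0,1]\to\mathrm{Imm}^1$ for which there is a partition $0=\tau_0<\dots<\tau_n=1$ such that $\alpha$ is $C^\infty$, as a map into the Banach space $C^1(S^1,\mathbb R^2)$, on each $[\tau_{i-1},\tau_i]$. Its length is $\mathcal L_{L^2(ds)}(\alpha)=\int_0^1\|\alpha'(t)\|_{\alpha(t),L^2(ds)}\,dt$, and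 the Riemannian distance $d_{L^2(ds)}(\gamma_0,\gamma_1)\in[0,\infty]$ is the infimum of $\mathcal L_{L^2(ds)}(\alpha)$ over all piecewise smooth paths $\alpha$ in $\mathrm{Imm}^1$ with $\alpha(0)=\gamma_0$ and $\alpha(1)=\gamma_1$. Theorem. If $\gamma_0,\gamma_1\in\mathrm{Imm}^1$ lie in the same path component of $\mathrm{Imm}^1$, then $d_{L^2(ds)}(\gamma_0,\gamma_1)=0$. -/

import Mathlib

open Set MeasureTheory
open scoped ENNReal ContDiff

noncomputable section

/-- The Euclidean plane `ℝ²`. -/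
abbrev Plane : Type := EuclideanSpace ℝ (Fin 2)

/-- The Banach space `C¹(S¹, ℝ²)`, where `S¹ = ℝ / ℤ` is the circle of length one. A continuously
differentiable map `f` is recorded together with its derivative, as the pair `(f, f')` of continuous
maps; the second entry is determined by the first one. The norm inherited from the product is the
`C¹` norm `max (sup |f|) (sup |f'|)`. -/
def c1Submodule : Submodule ℝ (C(UnitAddCircle, Plane) × C(UnitAddCircle, Plane)) where
  carrier := {p | ∀ u : ℝ,
    HasDerivAt (fun x : ℝ => p.1 (x : UnitAddCircle)) (p.2 (u : UnitAddCircle)) u}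
  add_mem' := fun hp hq u => (hp u).add (hq u)
  zero_mem' := fun u => hasDerivAt_const u (0 : Plane)
  smul_mem' := fun c _ hp u => (hp u).const_smul c

/-- The space `C¹(S¹, ℝ²)` with its `C¹` norm. -/
abbrev C1Curve : Type := c1Submodule

/-- The underlying map `S¹ → ℝ²` of an element of `C¹(S¹, ℝ²)`. -/
def C1Curve.toMap (γ : C1Curve) : C(UnitAddCircle, Plane) := γ.1.1

/-- The derivative `γ' : S¹ → ℝ²` of `γ ∈ C¹(S¹, ℝ²)`. -/
def C1Curve.derivative (γ : C1Curve) : C(UnitAddCircle, Plane) := γ.1.2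

/-- The space `Imm¹` of `C¹` immersions `S¹ → ℝ²`, a subset of `C¹(S¹, ℝ²)`. -/
def Imm1 : Set C1Curve := {γ | ∀ u : UnitAddCircle, γ.derivative u ≠ 0}

/-- The `L²(ds)` metric at `γ`: the integral of `⟨v, w⟩` with respect to the arc length
`ds = |γ'(u)| du` of `γ`. -/
def l2dsInner (γ v w : C1Curve) : ℝ :=
  ∫ u : UnitAddCircle, inner ℝ (v.toMap u) (w.toMap u) * ‖γ.derivative u‖

/-- The norm of the tangent vector `v` at `γ` in the `L²(ds)` metric. -/
def l2dsNorm (γ v : C1Curve) : ℝ := Real.sqrt (l2dsInner γ v v)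

/-- `α`, restricted to `[0, 1]`, is a piecewise smooth path in `Imm¹` from `γ₀` to `γ₁`: it is
continuous with values in `Imm¹`, and there are `0 = τ 0 ≤ τ 1 ≤ ⋯ ≤ τ n = 1` such that `α` is a
`C^∞` map into the Banach space `C¹(S¹, ℝ²)` on each closed interval `[τ i, τ (i + 1)]`. -/
structure IsPiecewiseSmoothPath (α : ℝ → C1Curve) (γ₀ γ₁ : Imm1) : Prop where
  source : α 0 = γ₀
  target : α 1 = γ₁
  mem_imm : ∀ t ∈ Icc (0 : ℝ) 1, α t ∈ Imm1
  continuousOn : ContinuousOn α (Icc 0 1)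
  piecewise_smooth : ∃ (n : ℕ) (τ : ℕ → ℝ), Monotone τ ∧ τ 0 = 0 ∧ τ n = 1 ∧
    ∀ i < n, ContDiffOn ℝ ∞ α (Icc (τ i) (τ (i + 1)))

/-- The `L²(ds)` length of the path `α` on `[0, 1]`: the integral of the `L²(ds)` norm (taken at
the point `α t`) of the velocity `α' t`, which exists off the finitely many break points. -/
def l2dsLength (α : ℝ → C1Curve) : ℝ≥0∞ :=
  ∫⁻ t in Icc (0 : ℝ) 1, ENNReal.ofReal (l2dsNorm (α t) (deriv α t))

/-- The Riemannian distance of the `L²(ds)` metric on `Imm¹`: the infimum of the lengths of the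
piecewise smooth paths in `Imm¹` that join the two curves (`∞` if there is no such path). -/
def l2dsDist (γ₀ γ₁ : Imm1) : ℝ≥0∞ :=
  ⨅ (α : ℝ → C1Curve) (_ : IsPiecewiseSmoothPath α γ₀ γ₁), l2dsLength α

end

noncomputable section

/-! The metric weights a motion by the arc length of the points that move, so a large displacement
is cheap when it is carried by points holding little length. Let `b` be transversal to `σ`, so that
every wave `σ ∘ φ + g (b ∘ φ)` with `φ' > 0` and `0 ≤ g ≤ 1` is immersed, however steep `g` is. Take
`N` teeth `m = sin² (π N u)`.

Reparametrize `σ` by some `φ` within `1 / N` of the identity with `∫ m φ' ≤ δ`; this costs `O(1 /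
N)`. Then grow the teeth from `g = 0` to `g = m` in thin slices, each moving only the tips. A slice
of height `1 / M` sees the steep sides only near its own level, so Cauchy–Schwarz over the slices
bounds the squared cost by a multiple of `∫ m φ'` plus `O(1 / M)`: in the limit the slope of `m`
disappears and `O(√δ)` remains (`curveDist_wave_grow_le`). Next slide the toothed curve to a
parametrization `ψ` concentrated where `1 - m` is small: points travel `O(1 / N)` on a curve of
length `O(N)`, at cost `O(N ^ (-1/2))` (`curveDist_wave_reparam_le`). Seen from `σ + b` the result
is a curve with teeth `(1 - m) (-b)`, which are removed as cheaply as the first ones were grown.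
Letting `N → ∞` and then `δ → 0` gives `curveDist_add_eq_zero`.

Near an immersion `γ` there is a `C¹` field `e` such that neither `e` nor its rotation is ever
parallel to `γ'`. A `C¹`-small displacement splits into a part along `e` and a part orthogonal to
it, both transversal, so the distance vanishes locally; a clopen argument makes this global. -/

instance : NormedAddCommGroup C1Curve := inferInstance

instance : NormedSpace ℝ C1Curve := inferInstance

instance : AddCommGroup C1Curve := inferInstance

instance : IsBoundedSMul ℝ C1Curve := NormedSpace.toIsBoundedSMul

/-! ### Curves as periodic functions on the line. -/

/-- The `1`-periodic function on `ℝ` underlying a `C¹` curve. -/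
def C1Curve.fn (γ : C1Curve) (u : ℝ) : Plane := γ.toMap u

/-- The `1`-periodic function on `ℝ` underlying the derivative of a `C¹` curve. -/
def C1Curve.dfn (γ : C1Curve) (u : ℝ) : Plane := γ.derivative u

namespace C1Curve

lemma hasDerivAt_fn (γ : C1Curve) (u : ℝ) : HasDerivAt γ.fn (γ.dfn u) u := γ.2 u

lemma fn_add_one (γ : C1Curve) (u : ℝ) : γ.fn (u + 1) = γ.fn u := by
  simp [fn]

@[fun_prop]
lemma continuous_dfn (γ : C1Curve) : Continuous γ.dfn :=
  γ.derivative.continuous.comp (AddCircle.continuous_mk' 1)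

@[fun_prop]
lemma continuous_fn (γ : C1Curve) : Continuous γ.fn :=
  γ.toMap.continuous.comp (AddCircle.continuous_mk' 1)

lemma norm_fn_le (γ : C1Curve) (u : ℝ) : ‖γ.fn u‖ ≤ ‖γ‖ :=
  (γ.1.1.norm_coe_le_norm u).trans (norm_fst_le γ.1)

lemma norm_dfn_le (γ : C1Curve) (u : ℝ) : ‖γ.dfn u‖ ≤ ‖γ‖ :=
  (γ.1.2.norm_coe_le_norm u).trans (norm_snd_le γ.1)

lemma norm_le_of_forall {γ : C1Curve} {C : ℝ} (hC : 0 ≤ C) (h0 : ∀ u, ‖γ.fn u‖ ≤ C)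
    (h1 : ∀ u, ‖γ.dfn u‖ ≤ C) : ‖γ‖ ≤ C := by
  refine max_le ((ContinuousMap.norm_le _ hC).2 fun x => ?_)
    ((ContinuousMap.norm_le _ hC).2 fun x => ?_)
  · obtain ⟨u, rfl⟩ := QuotientAddGroup.mk_surjective x
    exact h0 u
  · obtain ⟨u, rfl⟩ := QuotientAddGroup.mk_surjective x
    exact h1 u

lemma norm_fn_sub_le (γ : C1Curve) (x y : ℝ) : ‖γ.fn x - γ.fn y‖ ≤ ‖γ‖ * |x - y| :=
  convex_univ.norm_image_sub_le_of_norm_hasDerivWithin_le (f := γ.fn) (f' := γ.dfn)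
    (fun u _ => (γ.hasDerivAt_fn u).hasDerivWithinAt) (fun u _ => γ.norm_dfn_le u)
    (mem_univ y) (mem_univ x)

@[simp] lemma fn_add (γ η : C1Curve) (u : ℝ) : (γ + η).fn u = γ.fn u + η.fn u := rfl
@[simp] lemma fn_sub (γ η : C1Curve) (u : ℝ) : (γ - η).fn u = γ.fn u - η.fn u := rfl
@[simp] lemma fn_neg (γ : C1Curve) (u : ℝ) : (-γ).fn u = -γ.fn u := rfl
@[simp] lemma fn_smul (c : ℝ) (γ : C1Curve) (u : ℝ) : (c • γ).fn u = c • γ.fn u := rfl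
@[simp] lemma dfn_add (γ η : C1Curve) (u : ℝ) : (γ + η).dfn u = γ.dfn u + η.dfn u := rfl
@[simp] lemma dfn_sub (γ η : C1Curve) (u : ℝ) : (γ - η).dfn u = γ.dfn u - η.dfn u := rfl
@[simp] lemma dfn_neg (γ : C1Curve) (u : ℝ) : (-γ).dfn u = -γ.dfn u := rfl
@[simp] lemma dfn_smul (c : ℝ) (γ : C1Curve) (u : ℝ) : (c • γ).dfn u = c • γ.dfn u := rfl

lemma ext_fn {γ η : C1Curve} (h : ∀ u, γ.fn u = η.fn u) : γ = η := by
  have h' : γ.fn = η.fn := funext h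
  refine Subtype.ext (Prod.ext (ContinuousMap.ext fun x => ?_) (ContinuousMap.ext fun x => ?_))
  · obtain ⟨u, rfl⟩ := QuotientAddGroup.mk_surjective x
    exact h u
  · obtain ⟨u, rfl⟩ := QuotientAddGroup.mk_surjective x
    exact (γ.hasDerivAt_fn u).unique (h' ▸ η.hasDerivAt_fn u)

lemma mem_imm1_iff {γ : C1Curve} : γ ∈ Imm1 ↔ ∀ u, γ.dfn u ≠ 0 := by
  refine ⟨fun h u => h u, fun h x => ?_⟩
  obtain ⟨u, rfl⟩ := QuotientAddGroup.mk_surjective x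
  exact h u

/-- The `C¹` curve given by a `1`-periodic function with a continuous derivative. -/
def ofPeriodic (f f' : ℝ → Plane) (hf : ∀ u, HasDerivAt f (f' u) u) (hc : Continuous f')
    (hp : ∀ u, f (u + 1) = f u) : C1Curve :=
  have hp' : Function.Periodic f' 1 := fun u => by
    have h1 := (hf (u + 1)).comp_add_const u 1
    simp only [hp] at h1
    exact h1.unique (hf u)
  ⟨(⟨Function.Periodic.lift (f := f) (c := 1) hp, continuous_coinduced_dom.mpr
      (continuous_iff_continuousAt.2 fun u => (hf u).continuousAt)⟩,
    ⟨hp'.lift, continuous_coinduced_dom.mpr hc⟩), hf⟩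

end C1Curve

/-! ### The `L²(ds)` norm and openness of the immersions. -/

lemma l2dsInner_eq (γ v w : C1Curve) :
    l2dsInner γ v w = ∫ u in (0 : ℝ)..1, inner ℝ (v.fn u) (w.fn u) * ‖γ.dfn u‖ := by
  have := UnitAddCircle.intervalIntegral_preimage 0
    (fun u : UnitAddCircle => (inner ℝ (v.toMap u) (w.toMap u) * ‖γ.derivative u‖ : ℝ))
  rw [zero_add] at this
  exact this.symm

lemma l2dsNorm_eq (γ v : C1Curve) :
    l2dsNorm γ v = Real.sqrt (∫ u in (0 : ℝ)..1, ‖v.fn u‖ ^ 2 * ‖γ.dfn u‖) := by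
  simp only [l2dsNorm, l2dsInner_eq, real_inner_self_eq_norm_sq]

lemma l2dsNorm_smul (γ v : C1Curve) (c : ℝ) : l2dsNorm γ (c • v) = |c| * l2dsNorm γ v := by
  have h : ∀ u, ‖(c • v).fn u‖ ^ 2 * ‖γ.dfn u‖ = c ^ 2 * (‖v.fn u‖ ^ 2 * ‖γ.dfn u‖) := fun u => by
    simp [norm_smul, mul_pow, mul_assoc]
  simp only [l2dsNorm_eq, h, intervalIntegral.integral_const_mul]
  rw [Real.sqrt_mul (sq_nonneg c), Real.sqrt_sq_eq_abs]

lemma isOpen_imm1 : IsOpen Imm1 := by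
  have h : IsOpen {f : C(UnitAddCircle, Plane) | MapsTo f univ {0}ᶜ} :=
    ContinuousMap.isOpen_setOfPred_mapsTo isCompact_univ isOpen_compl_singleton
  have h2 : Imm1 = (fun γ : C1Curve => γ.1.2) ⁻¹' {f | MapsTo f univ {0}ᶜ} := by
    ext γ
    exact ⟨fun h u _ => h u, fun h u => h (mem_univ u)⟩
  rw [h2]
  exact h.preimage (continuous_snd.comp continuous_subtype_val)

/-! ### Reversal, concatenation and the triangle inequality. -/

/-- Length is unchanged, up to inequality, under an affine change of the time variable which maps
`(p, q)` into `(0, 1)`. -/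
lemma setLIntegral_comp_affine_le (α : ℝ → C1Curve) {δ : ℝ → C1Curve} {a c p q : ℝ} (ha : a ≠ 0)
    (hm : ∀ t ∈ Ioo p q, a * t + c ∈ Icc (0 : ℝ) 1)
    (hδ : ∀ t ∈ Ioo p q, δ t = α (a * t + c)) :
    ∫⁻ t in Ioo p q, ENNReal.ofReal (l2dsNorm (δ t) (deriv δ t)) ≤ l2dsLength α := by
  have hderiv : ∀ t ∈ Ioo p q, deriv δ t = a • deriv α (a * t + c) := fun t ht => by
    -- The interval is open, so the two paths agree near `t`; the rules for `deriv` used next need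
    -- no differentiability of `α`.
    have : δ =ᶠ[nhds t] fun s => (fun r => α (r + c)) (a * s) :=
      Filter.eventuallyEq_of_mem (isOpen_Ioo.mem_nhds ht) hδ
    rw [this.deriv_eq, deriv_comp_mul_left a (fun r => α (r + c)) t, deriv_comp_add_const]
  have himg : (fun t => a * t + c) '' Ioo p q ⊆ Icc 0 1 := by
    rintro _ ⟨t, ht, rfl⟩
    exact hm t ht
  refine le_trans (le_of_eq ?_) (lintegral_mono_set himg)
  rw [lintegral_image_eq_lintegral_abs_deriv_mul (f' := fun _ => a) measurableSet_Ioo]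
  · refine setLIntegral_congr_fun measurableSet_Ioo fun t ht => ?_
    rw [hδ t ht, hderiv t ht, l2dsNorm_smul, ENNReal.ofReal_mul (abs_nonneg a)]
  · intro t _
    simpa using (((hasDerivAt_id t).const_mul a).add_const c).hasDerivWithinAt
  · intro x _ y _ h
    simpa [ha] using h

lemma IsPiecewiseSmoothPath.reverse {α : ℝ → C1Curve} {γ₀ γ₁ : Imm1}
    (h : IsPiecewiseSmoothPath α γ₀ γ₁) :
    IsPiecewiseSmoothPath (fun t => α (-1 * t + 1)) γ₁ γ₀ := by
  have hmap : MapsTo (fun t : ℝ => -1 * t + 1) (Icc 0 1) (Icc 0 1) := fun t ht =>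
    ⟨by linarith [ht.2], by linarith [ht.1]⟩
  refine ⟨by simp [h.target], by simp [h.source], fun t ht => h.mem_imm _ (hmap ht),
    h.continuousOn.comp (by fun_prop) hmap, ?_⟩
  obtain ⟨n, τ, hτ, h0, h1, hs⟩ := h.piecewise_smooth
  refine ⟨n, fun i => 1 - τ (n - i), fun i j hij => ?_, by simp [h1], by simp [h0], ?_⟩
  · have := hτ (Nat.sub_le_sub_left hij n)
    simp only
    linarith
  · intro i hi
    have hs' := hs (n - (i + 1)) (by omega)
    rw [show n - (i + 1) + 1 = n - i by omega] at hs'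
    refine hs'.comp (t := Icc (τ (n - (i + 1))) (τ (n - i))) (by fun_prop) fun t ht => ?_
    exact ⟨by linarith [ht.2], by linarith [ht.1]⟩

lemma l2dsLength_reverse_le (α : ℝ → C1Curve) :
    l2dsLength (fun t => α (-1 * t + 1)) ≤ l2dsLength α := by
  conv_lhs => rw [l2dsLength, ← setLIntegral_congr (Ioo_ae_eq_Icc (a := (0 : ℝ)) (b := 1))]
  exact setLIntegral_comp_affine_le α (by norm_num)
    (fun t ht => ⟨by linarith [ht.2], by linarith [ht.1]⟩) fun t _ => rfl

lemma l2dsDist_comm_le (γ₀ γ₁ : Imm1) : l2dsDist γ₁ γ₀ ≤ l2dsDist γ₀ γ₁ :=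
  le_iInf₂ fun α h => (iInf₂_le (fun t => α (-1 * t + 1)) h.reverse).trans (l2dsLength_reverse_le α)

/-- Concatenation of two paths parametrized by `[0, 1]`. -/
def concatPath (α β : ℝ → C1Curve) (t : ℝ) : C1Curve :=
  if t ≤ 1 / 2 then α (2 * t + 0) else β (2 * t + -1)

lemma concatPath_right {α β : ℝ → C1Curve} (h : α 1 = β 0) {t : ℝ} (ht : 1 / 2 ≤ t) :
    concatPath α β t = β (2 * t + -1) := by
  rcases ht.eq_or_lt with rfl | ht
  · norm_num [concatPath, h]
  · rw [concatPath, if_neg (not_le.2 ht)]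

lemma concatPath_left {α β : ℝ → C1Curve} {t : ℝ} (ht : t ≤ 1 / 2) :
    concatPath α β t = α (2 * t + 0) := if_pos ht

lemma IsPiecewiseSmoothPath.concat {α β : ℝ → C1Curve} {γ₀ γ₁ γ₂ : Imm1}
    (hα : IsPiecewiseSmoothPath α γ₀ γ₁) (hβ : IsPiecewiseSmoothPath β γ₁ γ₂) :
    IsPiecewiseSmoothPath (concatPath α β) γ₀ γ₂ := by
  have hm : α 1 = β 0 := hα.target.trans hβ.source.symm
  refine ⟨by simp [concatPath, hα.source], ?_, fun t ht => ?_, ?_, ?_⟩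
  · rw [concatPath_right hm (by norm_num)]
    norm_num [hβ.target]
  · rcases le_total t (1 / 2) with h | h
    · rw [concatPath_left h]
      exact hα.mem_imm _ ⟨by linarith [ht.1], by linarith⟩
    · rw [concatPath_right hm h]
      exact hβ.mem_imm _ ⟨by linarith, by linarith [ht.2]⟩
  · have h1 : ContinuousOn (concatPath α β) (Icc 0 (1 / 2)) := by
      refine ContinuousOn.congr (hα.continuousOn.comp (f := fun t : ℝ => 2 * t + 0) (by fun_prop)
        fun t ht => ⟨by linarith [ht.1], by linarith [ht.2]⟩) fun t ht => concatPath_left ht.2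
    have h2 : ContinuousOn (concatPath α β) (Icc (1 / 2) 1) := by
      refine ContinuousOn.congr (hβ.continuousOn.comp (f := fun t : ℝ => 2 * t + -1) (by fun_prop)
        fun t ht => ⟨by linarith [ht.1], by linarith [ht.2]⟩) fun t ht => concatPath_right hm ht.1
    have := h1.union_of_isClosed h2 isClosed_Icc isClosed_Icc
    rwa [Icc_union_Icc_eq_Icc (by norm_num) (by norm_num)] at this
  · obtain ⟨n, τ, hτ, h0, h1, hs⟩ := hα.piecewise_smooth
    obtain ⟨k, σ, hσ, k0, k1, ks⟩ := hβ.piecewise_smooth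
    have hleft : ∀ i ≤ n, τ i ≤ 1 := fun i hi => h1 ▸ hτ hi
    have hright : ∀ i, 0 ≤ σ i := fun i => k0 ▸ hσ (Nat.zero_le i)
    refine ⟨n + k, fun i => if i ≤ n then τ i / 2 else (σ (i - n) + 1) / 2, ?_, by simp [h0], ?_, ?_⟩
    · intro i j hij
      simp only
      split_ifs with hi hj hj
      · linarith [hτ hij]
      · linarith [hleft i hi, hright (j - n)]
      · omega
      · linarith [hσ (Nat.sub_le_sub_right hij n)]
    -- `k = 0` would force `σ 0 = 0` and `σ 0 = 1`.
    · rcases Nat.eq_zero_or_pos k with rfl | hk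
      · exact absurd (k0.symm.trans k1) (by norm_num)
      · simp only
        rw [if_neg (by omega), Nat.add_sub_cancel_left, k1]
        norm_num
    · intro i hi
      rcases lt_or_ge i n with hin | hin
      · simp only
        rw [if_pos hin.le, if_pos (Nat.succ_le_of_lt hin)]
        refine ContDiffOn.congr (f := fun t => α (2 * t + 0)) ?_ fun t ht => concatPath_left ?_
        · exact (hs i hin).comp (by fun_prop) fun t ht =>
            ⟨by linarith [ht.1], by linarith [ht.2]⟩
        · linarith [ht.2, hleft (i + 1) hin]
      -- At the junction `i = n` both formulas give the break point `1 / 2`.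
      · have hi' : (if i ≤ n then τ i / 2 else (σ (i - n) + 1) / 2) = (σ (i - n) + 1) / 2 := by
          split_ifs with h
          · obtain rfl : i = n := le_antisymm h hin
            simp [h1, k0]
          · rfl
        simp only
        rw [hi', if_neg (by omega)]
        refine ContDiffOn.congr (f := fun t => β (2 * t + -1)) ?_ fun t ht =>
          concatPath_right hm ?_
        · have := ks (i - n) (by omega)
          rw [show i - n + 1 = i + 1 - n by omega] at this
          exact this.comp (by fun_prop) fun t ht => ⟨by linarith [ht.1], by linarith [ht.2]⟩
        · linarith [ht.1, hright (i - n)]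

lemma l2dsLength_concatPath_le {α β : ℝ → C1Curve} (hm : α 1 = β 0) :
    l2dsLength (concatPath α β) ≤ l2dsLength α + l2dsLength β := by
  conv_lhs => rw [l2dsLength, ← Icc_union_Icc_eq_Icc (show (0 : ℝ) ≤ 1 / 2 by norm_num)
    (show (1 / 2 : ℝ) ≤ 1 by norm_num)]
  refine (lintegral_union_le _ _ _).trans (add_le_add ?_ ?_)
  · rw [← setLIntegral_congr (Ioo_ae_eq_Icc (a := (0 : ℝ)) (b := 1 / 2))]
    exact setLIntegral_comp_affine_le α two_ne_zero
      (fun t ht => ⟨by linarith [ht.1], by linarith [ht.2]⟩) fun t ht => concatPath_left ht.2.le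
  · rw [← setLIntegral_congr (Ioo_ae_eq_Icc (a := (1 / 2 : ℝ)) (b := 1))]
    exact setLIntegral_comp_affine_le β two_ne_zero
      (fun t ht => ⟨by linarith [ht.1], by linarith [ht.2]⟩) fun t ht => concatPath_right hm ht.1.le

lemma l2dsDist_triangle (γ₀ γ₁ γ₂ : Imm1) :
    l2dsDist γ₀ γ₂ ≤ l2dsDist γ₀ γ₁ + l2dsDist γ₁ γ₂ := by
  unfold l2dsDist
  simp only [ENNReal.iInf_add, ENNReal.add_iInf]
  refine le_iInf₂ fun β hβ => le_iInf₂ fun α hα => ?_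
  exact (iInf₂_le (concatPath α β) (hα.concat hβ)).trans
    (l2dsLength_concatPath_le (hα.target.trans hβ.source.symm))

/-! ### The distance on all curves, and chains of segments. -/

/-- The Riemannian distance, extended by `∞` to curves which are not immersed. -/
def curveDist (γ η : C1Curve) : ℝ≥0∞ := ⨅ (hγ : γ ∈ Imm1) (hη : η ∈ Imm1), l2dsDist ⟨γ, hγ⟩ ⟨η, hη⟩

lemma curveDist_coe (γ η : Imm1) : curveDist γ η = l2dsDist γ η := by
  simp [curveDist, γ.2, η.2]

lemma curveDist_comm (γ η : C1Curve) : curveDist γ η = curveDist η γ :=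
  le_antisymm
    (le_iInf₂ fun h1 h2 => (iInf₂_le h2 h1).trans (l2dsDist_comm_le _ _))
    (le_iInf₂ fun h1 h2 => (iInf₂_le h2 h1).trans (l2dsDist_comm_le _ _))

lemma curveDist_triangle (γ₀ γ₁ γ₂ : C1Curve) :
    curveDist γ₀ γ₂ ≤ curveDist γ₀ γ₁ + curveDist γ₁ γ₂ := by
  by_cases h : γ₀ ∈ Imm1 ∧ γ₁ ∈ Imm1 ∧ γ₂ ∈ Imm1
  · obtain ⟨h0, h1, h2⟩ := h
    simpa [curveDist, h0, h1, h2] using l2dsDist_triangle ⟨γ₀, h0⟩ ⟨γ₁, h1⟩ ⟨γ₂, h2⟩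
  -- If one of the curves is not immersed, a term on the right is `∞`.
  · by_cases h0 : γ₀ ∈ Imm1 <;> by_cases h1 : γ₁ ∈ Imm1 <;> by_cases h2 : γ₂ ∈ Imm1 <;>
      simp_all [curveDist]

/-- The distance of two curves is bounded by the length of the segment that joins them. -/
lemma curveDist_le_of_segment {γ η : C1Curve} {c : ℝ}
    (hseg : ∀ t ∈ Icc (0 : ℝ) 1, γ + t • (η - γ) ∈ Imm1)
    (hc : ∫ u in (0 : ℝ)..1, ‖η.fn u - γ.fn u‖ ^ 2 * (‖γ.dfn u‖ + ‖η.dfn u‖) ≤ c) :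
    curveDist γ η ≤ ENNReal.ofReal (Real.sqrt c) := by
  have h0 : γ ∈ Imm1 := by simpa using hseg 0 (by simp)
  have h1 : η ∈ Imm1 := by simpa only [one_smul, add_sub_cancel] using hseg 1 (by simp)
  have hsm : ContDiff ℝ ∞ fun t : ℝ => γ + t • (η - γ) := by fun_prop
  refine (iInf₂_le h0 h1).trans ((iInf₂_le (fun t : ℝ => γ + t • (η - γ)) ?_).trans ?_)
  · refine ⟨by simp, by simp only [one_smul, add_sub_cancel], hseg, hsm.continuous.continuousOn, 1, fun i => i,
      Nat.mono_cast, by simp, by simp, fun i _ => hsm.contDiffOn⟩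
  · have hle : ∀ t ∈ Icc (0 : ℝ) 1, ENNReal.ofReal (l2dsNorm (γ + t • (η - γ))
        (deriv (fun t : ℝ => γ + t • (η - γ)) t)) ≤ ENNReal.ofReal (Real.sqrt c) := by
      intro t ht
      have hd : deriv (fun t : ℝ => γ + t • (η - γ)) t = η - γ := by
        simpa using (((hasDerivAt_id t).smul_const (η - γ)).const_add γ).deriv
      rw [hd, l2dsNorm_eq]
      refine ENNReal.ofReal_le_ofReal (Real.sqrt_le_sqrt (le_trans ?_ hc))
      refine intervalIntegral.integral_mono_on zero_le_one
        (Continuous.intervalIntegrable (by fun_prop) _ _)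
        (Continuous.intervalIntegrable (by fun_prop) _ _) fun u _ => ?_
      simp only [C1Curve.fn_sub, C1Curve.dfn_add, C1Curve.dfn_smul, C1Curve.dfn_sub]
      gcongr
      -- The velocity along the segment is a convex combination of the two end velocities, so its
      -- norm is at most their sum, uniformly in `t`.
      have : γ.dfn u + t • (η.dfn u - γ.dfn u) = (1 - t) • γ.dfn u + t • η.dfn u := by module
      rw [this]
      refine (norm_add_le _ _).trans ?_
      rw [norm_smul, norm_smul, Real.norm_of_nonneg (by linarith [ht.2]), Real.norm_of_nonneg ht.1]
      have := norm_nonneg (γ.dfn u)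
      have := norm_nonneg (η.dfn u)
      nlinarith [ht.1, ht.2]
    refine (setLIntegral_mono' measurableSet_Icc hle).trans ?_
    simp

lemma curveDist_self {γ : C1Curve} (h : γ ∈ Imm1) : curveDist γ γ = 0 := by
  have := curveDist_le_of_segment (γ := γ) (η := γ) (c := 0)
    (by simp only [sub_self, smul_zero, add_zero]; exact fun _ _ => h) (by simp)
  simpa using this

lemma curveDist_le_sum (P : ℕ → C1Curve) (h0 : P 0 ∈ Imm1) (n : ℕ) :
    curveDist (P 0) (P n) ≤ ∑ i ∈ Finset.range n, curveDist (P i) (P (i + 1)) := by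
  induction n with
  | zero => simp [curveDist_self h0]
  | succ n ih =>
    rw [Finset.sum_range_succ]
    exact (curveDist_triangle _ (P n) _).trans (by gcongr)

/-! ### Lifts of circle maps and periodic functions. -/

/-- A `C¹` function `f : ℝ → ℝ` with `f (u + 1) = f u + d`: the lift of a map of degree `d` of the
circle if `d` is an integer, a `1`-periodic function if `d = 0`. -/
structure CircleLift (d : ℝ) where
  /-- the function -/
  toFun : ℝ → ℝ
  /-- its derivative -/
  der : ℝ → ℝ
  hasDerivAt : ∀ u, HasDerivAt toFun (der u) u
  continuous_der : Continuous der
  shift : ∀ u, toFun (u + 1) = toFun u + d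

namespace CircleLift

instance (d : ℝ) : CoeFun (CircleLift d) fun _ => ℝ → ℝ := ⟨toFun⟩

attribute [fun_prop] continuous_der

@[fun_prop]
lemma continuous {d : ℝ} (f : CircleLift d) : Continuous f :=
  continuous_iff_continuousAt.2 fun u => (f.hasDerivAt u).continuousAt

lemma integral_der {d : ℝ} (f : CircleLift d) : ∫ u in (0 : ℝ)..1, f.der u = d := by
  rw [intervalIntegral.integral_eq_sub_of_hasDerivAt (fun u _ => f.hasDerivAt u)
    (f.continuous_der.intervalIntegrable _ _)]
  have := f.shift 0
  rw [zero_add] at this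
  rw [this]
  ring

/-- The affine path from `f` to `g`. -/
def lerp {d : ℝ} (f g : CircleLift d) (s : ℝ) : CircleLift d where
  toFun u := f u + s * (g u - f u)
  der u := f.der u + s * (g.der u - f.der u)
  hasDerivAt u := (f.hasDerivAt u).add (((g.hasDerivAt u).sub (f.hasDerivAt u)).const_mul s)
  continuous_der := by fun_prop
  shift u := by rw [f.shift, g.shift]; ring

/-- The identity. -/
def id : CircleLift 1 where
  toFun u := u
  der _ := 1
  hasDerivAt u := hasDerivAt_id u
  continuous_der := continuous_const
  shift _ := rfl

instance : Zero (CircleLift 0) := ⟨⟨fun _ => 0, fun _ => 0, fun u => hasDerivAt_const u 0,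
  continuous_const, fun _ => (add_zero 0).symm⟩⟩

/-- The function `1 - f`. -/
def oneSub (f : CircleLift 0) : CircleLift 0 where
  toFun u := 1 - f u
  der u := -f.der u
  hasDerivAt u := (f.hasDerivAt u).const_sub 1
  continuous_der := by fun_prop
  shift u := by rw [f.shift]; ring

end CircleLift

/-! ### Transversal displacements and waves. -/

/-- `b` is transversal to `σ`: the curve `σ + g b` is immersed, and its velocity is nowhere
parallel to `b`, for every constant `g ∈ [0, 1]`. -/
def Transversal (σ b : C1Curve) : Prop :=
  ∀ u : ℝ, ∀ g ∈ Icc (0 : ℝ) 1, ∀ l : ℝ, σ.dfn u + g • b.dfn u + l • b.fn u ≠ 0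

/-- Replacing `g` by `1 - g` exchanges the two ends; with `wave_flip` it lets teeth be removed
towards `σ + b` by the estimate that grows them from `σ`. -/
lemma Transversal.flip {σ b : C1Curve} (h : Transversal σ b) : Transversal (σ + b) (-b) := by
  intro u g hg l
  have := h u (1 - g) ⟨by linarith [hg.2], by linarith [hg.1]⟩ (-l)
  convert this using 1
  simp only [C1Curve.dfn_add, C1Curve.dfn_neg, C1Curve.fn_neg]
  module

/-- The curve `σ ∘ φ + g (b ∘ φ)`. -/
def wave (σ b : C1Curve) (φ : CircleLift 1) (g : CircleLift 0) : C1Curve :=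
  C1Curve.ofPeriodic (fun u => σ.fn (φ u) + g u • b.fn (φ u))
    (fun u => φ.der u • σ.dfn (φ u) + (g u • φ.der u • b.dfn (φ u) + g.der u • b.fn (φ u)))
    (fun u => ((σ.hasDerivAt_fn (φ u)).scomp u (φ.hasDerivAt u)).add
      ((g.hasDerivAt u).smul ((b.hasDerivAt_fn (φ u)).scomp u (φ.hasDerivAt u))))
    (by fun_prop)
    (fun u => by rw [φ.shift, g.shift, σ.fn_add_one, b.fn_add_one, add_zero])

lemma wave_fn (σ b : C1Curve) (φ : CircleLift 1) (g : CircleLift 0) (u : ℝ) :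
    (wave σ b φ g).fn u = σ.fn (φ u) + g u • b.fn (φ u) := rfl

lemma wave_dfn (σ b : C1Curve) (φ : CircleLift 1) (g : CircleLift 0) (u : ℝ) :
    (wave σ b φ g).dfn u =
      φ.der u • σ.dfn (φ u) + (g u • φ.der u • b.dfn (φ u) + g.der u • b.fn (φ u)) := rfl

lemma wave_id_zero (σ b : C1Curve) : wave σ b CircleLift.id 0 = σ :=
  C1Curve.ext_fn fun u => by
    rw [wave_fn]
    exact (congrArg _ (zero_smul ℝ _)).trans (add_zero _)

lemma wave_flip (σ b : C1Curve) (φ : CircleLift 1) (g : CircleLift 0) :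
    wave (σ + b) (-b) φ g.oneSub = wave σ b φ g :=
  C1Curve.ext_fn fun u => by
    rw [wave_fn, wave_fn, C1Curve.fn_add, C1Curve.fn_neg]
    change _ + (1 - g u) • _ = _
    module

/-- For fixed `φ` a wave is affine in `g`, so straight segments between waves consist of waves and
stay immersed. -/
lemma wave_lerp (σ b : C1Curve) (φ : CircleLift 1) (g₀ g₁ : CircleLift 0) (s : ℝ) :
    wave σ b φ g₀ + s • (wave σ b φ g₁ - wave σ b φ g₀) = wave σ b φ (g₀.lerp g₁ s) :=
  C1Curve.ext_fn fun u => by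
    simp only [wave_fn, C1Curve.fn_add, C1Curve.fn_smul, C1Curve.fn_sub, CircleLift.lerp]
    module

/-- Divided by `φ'`, the velocity is `σ' + g b' + (g' / φ') b` at `φ u`. The coefficient of `b` is
unrestricted in `Transversal`, so the slope of `g` does not matter. -/
lemma wave_mem_imm1 {σ b : C1Curve} (h : Transversal σ b) {φ : CircleLift 1}
    (hφ : ∀ u, 0 < φ.der u) {g : CircleLift 0} (hg : ∀ u, g u ∈ Icc (0 : ℝ) 1) :
    wave σ b φ g ∈ Imm1 := by
  refine C1Curve.mem_imm1_iff.2 fun u hu => h (φ u) (g u) (hg u) (g.der u / φ.der u) ?_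
  have := congrArg (fun x => (φ.der u)⁻¹ • x) hu
  simp only [smul_zero] at this
  rw [← this, wave_dfn]
  have h0 := (hφ u).ne'
  match_scalars <;> field_simp

lemma norm_wave_dfn_le (σ b : C1Curve) {φ : CircleLift 1} (hφ : ∀ u, 0 < φ.der u)
    {g : CircleLift 0} (hg : ∀ u, g u ∈ Icc (0 : ℝ) 1) (u : ℝ) :
    ‖(wave σ b φ g).dfn u‖ ≤ (‖σ‖ + ‖b‖) * φ.der u + ‖b‖ * |g.der u| := by
  rw [wave_dfn]
  have h1 : ‖φ.der u • σ.dfn (φ u)‖ ≤ φ.der u * ‖σ‖ := by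
    rw [norm_smul, Real.norm_of_nonneg (hφ u).le]
    exact mul_le_mul_of_nonneg_left (σ.norm_dfn_le _) (hφ u).le
  have h2 : ‖g u • φ.der u • b.dfn (φ u)‖ ≤ 1 * (φ.der u * ‖b‖) := by
    rw [norm_smul, norm_smul, Real.norm_of_nonneg (hφ u).le, Real.norm_of_nonneg (hg u).1]
    have := mul_le_mul_of_nonneg_left (b.norm_dfn_le (φ u)) (hφ u).le
    exact mul_le_mul (hg u).2 this (mul_nonneg (hφ u).le (norm_nonneg _)) zero_le_one
  have h3 : ‖g.der u • b.fn (φ u)‖ ≤ |g.der u| * ‖b‖ := by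
    rw [norm_smul, Real.norm_eq_abs]
    exact mul_le_mul_of_nonneg_left (b.norm_fn_le _) (abs_nonneg _)
  linarith [norm_add_le (φ.der u • σ.dfn (φ u))
    (g u • φ.der u • b.dfn (φ u) + g.der u • b.fn (φ u)),
    norm_add_le (g u • φ.der u • b.dfn (φ u)) (g.der u • b.fn (φ u))]

/-! ### Homotopies and reparametrizations. -/

/-- The length of a homotopy that moves every point by a small amount. -/
lemma curveDist_le_of_homotopy {T : ℝ → C1Curve} {L B : ℝ} (hL : 0 ≤ L)
    (hT : ContinuousOn T (Icc 0 1)) (himm : ∀ s ∈ Icc (0 : ℝ) 1, T s ∈ Imm1)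
    (hlip : ∀ s ∈ Icc (0 : ℝ) 1, ∀ r ∈ Icc (0 : ℝ) 1, ∀ u,
      ‖(T s).fn u - (T r).fn u‖ ≤ L * |s - r|)
    (hB : ∀ s ∈ Icc (0 : ℝ) 1, ∫ u in (0 : ℝ)..1, ‖(T s).dfn u‖ ≤ B) :
    curveDist (T 0) (T 1) ≤ ENNReal.ofReal (L * Real.sqrt (2 * B)) := by
  -- `T` need not be differentiable into `C¹`, as happens for reparametrizations of a `C¹` curve, so
  -- it is replaced by a broken line. By compactness the image of `T` has a `δ`-neighbourhood of
  -- immersions, and a fine enough subdivision keeps the segments inside it.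
  obtain ⟨δ, hδ, hsub⟩ := (isCompact_Icc.image_of_continuousOn hT).exists_thickening_subset_open
    isOpen_imm1 (image_subset_iff.2 himm)
  obtain ⟨ε, hε, huc⟩ := Metric.uniformContinuousOn_iff.1
    (isCompact_Icc.uniformContinuousOn_of_continuous hT) δ hδ
  obtain ⟨n, hn⟩ := exists_nat_one_div_lt hε
  set k : ℝ := n + 1 with hk
  have hk0 : 0 < k := by positivity
  have hmem : ∀ i ≤ n + 1, (i : ℝ) / k ∈ Icc (0 : ℝ) 1 := fun i hi =>
    ⟨by positivity, (div_le_one hk0).2 (by rw [hk]; exact_mod_cast hi)⟩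
  have hstep : ∀ i : ℕ, ((i + 1 : ℕ) : ℝ) / k - i / k = 1 / k := fun i => by
    push_cast
    ring
  have hseg : ∀ i ∈ Finset.range (n + 1), curveDist (T ((i : ℕ) / k)) (T ((i + 1 : ℕ) / k)) ≤
      ENNReal.ofReal (Real.sqrt ((L / k) ^ 2 * (2 * B))) := by
    intro i hi
    have hi' : i + 1 ≤ n + 1 := Finset.mem_range.1 hi
    have h0 := hmem i (by omega)
    have h1 := hmem (i + 1) hi'
    refine curveDist_le_of_segment (fun t ht => hsub ?_) ?_
    · refine Metric.mem_thickening_iff.2 ⟨T (i / k), mem_image_of_mem _ h0, ?_⟩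
      have hd : dist (T ((i + 1 : ℕ) / k)) (T (i / k)) < δ := by
        refine huc _ h1 _ h0 ?_
        rw [Real.dist_eq, hstep, abs_of_pos (by positivity)]
        exact hn
      rw [dist_eq_norm, add_sub_cancel_left, norm_smul, Real.norm_of_nonneg ht.1]
      rw [dist_eq_norm] at hd
      exact (mul_le_of_le_one_left (norm_nonneg _) ht.2).trans_lt hd
    · calc _ ≤ ∫ u in (0 : ℝ)..1, (L / k) ^ 2 *
            (‖(T (i / k)).dfn u‖ + ‖(T ((i + 1 : ℕ) / k)).dfn u‖) := by
            refine intervalIntegral.integral_mono_on zero_le_one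
              (Continuous.intervalIntegrable (by fun_prop) _ _)
              (Continuous.intervalIntegrable (by fun_prop) _ _) fun u _ => ?_
            have := hlip _ h1 _ h0 u
            rw [hstep, abs_of_pos (by positivity), mul_one_div] at this
            gcongr
        _ ≤ _ := by
            rw [intervalIntegral.integral_const_mul, intervalIntegral.integral_add
              (Continuous.intervalIntegrable (by fun_prop) _ _)
              (Continuous.intervalIntegrable (by fun_prop) _ _)]
            have := hB _ h0
            have := hB _ h1
            gcongr
            linarith
  have := (curveDist_le_sum (fun i : ℕ => T (i / k)) (himm _ (hmem 0 (by omega))) (n + 1)).trans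
    (Finset.sum_le_sum hseg)
  have hlast : ((n + 1 : ℕ) : ℝ) / k = 1 := by
    rw [hk]
    push_cast
    exact div_self hk0.ne'
  simp only [Nat.cast_zero, zero_div, hlast] at this
  refine this.trans (le_of_eq ?_)
  -- There are `k` segments, each of length at most `(L / k) √(2 B)`.
  rw [Finset.sum_const, Finset.card_range, Real.sqrt_mul (sq_nonneg _),
    Real.sqrt_sq (by positivity), nsmul_eq_mul, ← ENNReal.ofReal_natCast,
    ← ENNReal.ofReal_mul (by positivity)]
  congr 1
  push_cast
  rw [← hk]
  field_simp

/-- Joint continuity descends along the open quotient map from the line to the circle, and currying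
turns it into continuity for the uniform topology. -/
lemma continuous_of_continuous_uncurry {T : ℝ → C1Curve}
    (h0 : Continuous fun p : ℝ × ℝ => (T p.1).fn p.2)
    (h1 : Continuous fun p : ℝ × ℝ => (T p.1).dfn p.2) : Continuous T := by
  have key : ∀ F : ℝ → C(UnitAddCircle, Plane),
      (Continuous fun p : ℝ × ℝ => F p.1 (p.2 : UnitAddCircle)) → Continuous F := by
    intro F hF
    refine ContinuousMap.continuous_of_continuous_uncurry F ?_
    have hq : IsOpenQuotientMap (Prod.map id ((↑) : ℝ → UnitAddCircle) : ℝ × ℝ → _) :=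
      IsOpenQuotientMap.id.prodMap QuotientAddGroup.isOpenQuotientMap_mk
    exact hq.isQuotientMap.continuous_iff.2 hF
  exact Continuous.subtype_mk (Continuous.prodMk (key (fun s => (T s).1.1) h0)
    (key (fun s => (T s).1.2) h1)) fun s => (T s).2

/-- Changing the parametrization of a curve by a small amount costs little length. -/
lemma curveDist_wave_reparam_le {σ b : C1Curve} (h : Transversal σ b) {φ ψ : CircleLift 1}
    (hφ : ∀ u, 0 < φ.der u) (hψ : ∀ u, 0 < ψ.der u) {g : CircleLift 0}
    (hg : ∀ u, g u ∈ Icc (0 : ℝ) 1) {ρ D : ℝ} (hρ : ∀ u, |ψ u - φ u| ≤ ρ)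
    (hD : ∀ u, |g.der u| ≤ D) :
    curveDist (wave σ b φ g) (wave σ b ψ g) ≤ ENNReal.ofReal
      ((‖σ‖ + ‖b‖) * ρ * Real.sqrt (2 * ((‖σ‖ + ‖b‖) + ‖b‖ * D))) := by
  have hρ0 : 0 ≤ ρ := (abs_nonneg _).trans (hρ 0)
  have hpos : ∀ s ∈ Icc (0 : ℝ) 1, ∀ u, 0 < (φ.lerp ψ s).der u := fun s hs u => by
    change 0 < φ.der u + s * (ψ.der u - φ.der u)
    rcases hs.2.lt_or_eq with h1 | rfl
    · nlinarith [hφ u, hψ u, mul_pos (sub_pos.2 h1) (hφ u), mul_nonneg hs.1 (hψ u).le]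
    · linarith [hψ u]
  have key := curveDist_le_of_homotopy (T := fun s => wave σ b (φ.lerp ψ s) g)
    (L := (‖σ‖ + ‖b‖) * ρ) (B := (‖σ‖ + ‖b‖) + ‖b‖ * D) (by positivity) ?_
    (fun s hs => wave_mem_imm1 h (hpos s hs) hg) ?_ ?_
  · convert key using 2 <;> refine congrArg (fun x => wave σ b x g) ?_ <;>
      simp [CircleLift.lerp]
  · refine (continuous_of_continuous_uncurry ?_ ?_).continuousOn
    · simp only [wave_fn, CircleLift.lerp]
      fun_prop
    · simp only [wave_dfn, CircleLift.lerp]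
      fun_prop
  · intro s _ r _ u
    have hsr : |(φ.lerp ψ s) u - (φ.lerp ψ r) u| ≤ ρ * |s - r| := by
      change |φ u + s * (ψ u - φ u) - (φ u + r * (ψ u - φ u))| ≤ _
      rw [show φ u + s * (ψ u - φ u) - (φ u + r * (ψ u - φ u)) = (ψ u - φ u) * (s - r) by ring,
        abs_mul]
      exact mul_le_mul_of_nonneg_right (hρ u) (abs_nonneg _)
    simp only [wave_fn]
    rw [add_sub_add_comm, ← smul_sub]
    refine (norm_add_le _ _).trans ?_
    rw [norm_smul, Real.norm_of_nonneg (hg u).1]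
    have h1 := (σ.norm_fn_sub_le ((φ.lerp ψ s) u) ((φ.lerp ψ r) u)).trans
      (mul_le_mul_of_nonneg_left hsr (norm_nonneg _))
    have h2 := (b.norm_fn_sub_le ((φ.lerp ψ s) u) ((φ.lerp ψ r) u)).trans
      (mul_le_mul_of_nonneg_left hsr (norm_nonneg _))
    have h3 := mul_le_of_le_one_left (norm_nonneg (b.fn ((φ.lerp ψ s) u) -
      b.fn ((φ.lerp ψ r) u))) (hg u).2
    linarith
  · intro s hs
    -- The length bound is independent of the parametrization because `φ'` always has integral one.
    calc _ ≤ ∫ u in (0 : ℝ)..1, ((‖σ‖ + ‖b‖) * (φ.lerp ψ s).der u + ‖b‖ * D) := by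
          refine intervalIntegral.integral_mono_on zero_le_one
            (Continuous.intervalIntegrable (by fun_prop) _ _)
            (Continuous.intervalIntegrable (by fun_prop) _ _) fun u _ => ?_
          refine (norm_wave_dfn_le σ b (hpos s hs) hg u).trans ?_
          have := mul_le_mul_of_nonneg_left (hD u) (norm_nonneg b)
          linarith
      _ = _ := by
          rw [intervalIntegral.integral_add (Continuous.intervalIntegrable (by fun_prop) _ _)
            (Continuous.intervalIntegrable (by fun_prop) _ _),
            intervalIntegral.integral_const_mul, CircleLift.integral_der,
            intervalIntegral.integral_const]
          rw [mul_one, sub_zero, one_smul]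

lemma curveDist_wave_step_le {σ b : C1Curve} (h : Transversal σ b) {φ : CircleLift 1}
    (hφ : ∀ u, 0 < φ.der u) {g₀ g₁ : CircleLift 0} (h0 : ∀ u, g₀ u ∈ Icc (0 : ℝ) 1)
    (h1 : ∀ u, g₁ u ∈ Icc (0 : ℝ) 1) :
    curveDist (wave σ b φ g₀) (wave σ b φ g₁) ≤ ENNReal.ofReal (Real.sqrt
      (∫ u in (0 : ℝ)..1, ‖b‖ ^ 2 * ((g₁ u - g₀ u) ^ 2 *
        (2 * (‖σ‖ + ‖b‖) * φ.der u + ‖b‖ * (|g₀.der u| + |g₁.der u|))))) := by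
  refine curveDist_le_of_segment (fun t ht => ?_) ?_
  · rw [wave_lerp]
    refine wave_mem_imm1 h hφ fun u => ?_
    have := (convex_Icc (0 : ℝ) 1).add_smul_sub_mem (h0 u) (h1 u) ht
    simpa [CircleLift.lerp] using this
  · refine intervalIntegral.integral_mono_on zero_le_one
      (Continuous.intervalIntegrable (by fun_prop) _ _)
      (Continuous.intervalIntegrable (by fun_prop) _ _) fun u _ => ?_
    have e : (wave σ b φ g₁).fn u - (wave σ b φ g₀).fn u = (g₁ u - g₀ u) • b.fn (φ u) := by
      simp only [wave_fn]
      module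
    rw [e, norm_smul, mul_pow, Real.norm_eq_abs, sq_abs, mul_comm ((g₁ u - g₀ u) ^ 2), mul_assoc]
    have hsum : ‖(wave σ b φ g₀).dfn u‖ + ‖(wave σ b φ g₁).dfn u‖ ≤
        2 * (‖σ‖ + ‖b‖) * φ.der u + ‖b‖ * (|g₀.der u| + |g₁.der u|) := by
      linarith [norm_wave_dfn_le σ b hφ h0 u, norm_wave_dfn_le σ b hφ h1 u]
    have := b.norm_fn_le (φ u)
    gcongr

/-! ### Smooth truncation at height `j / M`. -/

/-- The piecewise linear function which is `0` on `(-∞, 0]` and `1` on `[1, ∞)`. -/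
def ramp (x : ℝ) : ℝ := max 0 (min 1 x)

@[fun_prop]
lemma continuous_ramp : Continuous ramp := by unfold ramp; fun_prop

lemma ramp_mono : Monotone ramp := fun _ _ h => max_le_max le_rfl (min_le_min le_rfl h)

lemma ramp_nonneg (x : ℝ) : 0 ≤ ramp x := le_max_left _ _

lemma ramp_le_one (x : ℝ) : ramp x ≤ 1 := max_le zero_le_one (min_le_left _ _)

lemma ramp_of_nonpos {x : ℝ} (h : x ≤ 0) : ramp x = 0 :=
  max_eq_left ((min_le_right _ _).trans h)

lemma ramp_of_one_le {x : ℝ} (h : 1 ≤ x) : ramp x = 1 := by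
  rw [ramp, min_eq_left h, max_eq_right zero_le_one]

/-- A `C¹` approximation of `x ↦ min x (j / M)`. -/
def softMin (M j : ℕ) (x : ℝ) : ℝ := ∫ y in (0 : ℝ)..x, ramp (j - M * y)

section softMin

variable {M : ℕ} {x : ℝ}

lemma hasDerivAt_softMin (M j : ℕ) (x : ℝ) :
    HasDerivAt (softMin M j) (ramp (j - M * x)) x := by
  have hc : Continuous fun y : ℝ => ramp (j - M * y) := by fun_prop
  exact intervalIntegral.integral_hasDerivAt_right (hc.intervalIntegrable _ _)
    (hc.stronglyMeasurableAtFilter _ _) hc.continuousAt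

lemma intervalIntegrable_ramp (M j : ℕ) (a b : ℝ) :
    IntervalIntegrable (fun y : ℝ => ramp (j - M * y)) volume a b :=
  Continuous.intervalIntegrable (by fun_prop) _ _

lemma softMin_mem (M j : ℕ) (hx : x ∈ Icc (0 : ℝ) 1) : softMin M j x ∈ Icc (0 : ℝ) 1 := by
  refine ⟨intervalIntegral.integral_nonneg hx.1 fun y _ => ramp_nonneg _, ?_⟩
  have := intervalIntegral.integral_mono_on hx.1 (intervalIntegrable_ramp M j 0 x)
    (continuous_const.intervalIntegrable (μ := volume) 0 x) fun y _ => ramp_le_one (j - M * y)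
  rw [intervalIntegral.integral_const, smul_eq_mul, mul_one, sub_zero] at this
  exact this.trans hx.2

lemma softMin_zero (hx : 0 ≤ x) : softMin M 0 x = 0 := by
  rw [softMin, intervalIntegral.integral_congr (g := fun _ => (0 : ℝ))]
  · simp
  · intro y hy
    rw [uIcc_of_le hx] at hy
    refine ramp_of_nonpos ?_
    have := mul_nonneg (Nat.cast_nonneg (α := ℝ) M) hy.1
    simpa using this

lemma softMin_last (hx : x ∈ Icc (0 : ℝ) 1) : softMin M (M + 1) x = x := by
  rw [softMin, intervalIntegral.integral_congr (g := fun _ => (1 : ℝ))]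
  · simp
  · intro y hy
    rw [uIcc_of_le hx.1] at hy
    refine ramp_of_one_le ?_
    have := mul_le_mul_of_nonneg_left (hy.2.trans hx.2) (Nat.cast_nonneg (α := ℝ) M)
    push_cast
    linarith

lemma softMin_succ_sub (M j : ℕ) (x : ℝ) : softMin M (j + 1) x - softMin M j x =
    ∫ y in (0 : ℝ)..x, (ramp ((j + 1 : ℕ) - M * y) - ramp (j - M * y)) :=
  (intervalIntegral.integral_sub (intervalIntegrable_ramp M (j + 1) 0 x)
    (intervalIntegrable_ramp M j 0 x)).symm

lemma softMin_le_succ (M j : ℕ) (hx : 0 ≤ x) : softMin M j x ≤ softMin M (j + 1) x := by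
  rw [← sub_nonneg, softMin_succ_sub]
  refine intervalIntegral.integral_nonneg hx fun y _ => sub_nonneg.2 (ramp_mono ?_)
  push_cast
  linarith

lemma softMin_succ_eq {j : ℕ} (hx : 0 ≤ x) (hj : M * x + 1 ≤ j) :
    softMin M (j + 1) x - softMin M j x = 0 := by
  rw [softMin_succ_sub, intervalIntegral.integral_congr (g := fun _ => (0 : ℝ))]
  · simp
  · intro y hy
    rw [uIcc_of_le hx] at hy
    have := mul_le_mul_of_nonneg_left hy.2 (Nat.cast_nonneg (α := ℝ) M)
    simp only
    rw [ramp_of_one_le, ramp_of_one_le, sub_self]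
    · linarith
    · push_cast
      linarith

/-- Raising `j` by one translates the integrand by `1 / M`, and the integrand lies in `[0, 1]`. -/
lemma softMin_succ_sub_le (hM : 0 < M) (j : ℕ) (x : ℝ) :
    softMin M (j + 1) x - softMin M j x ≤ 1 / M := by
  have hM' : (0 : ℝ) < M := by exact_mod_cast hM
  have hshift : softMin M (j + 1) x = ∫ y in (0 - 1 / M : ℝ)..(x - 1 / M), ramp (j - M * y) := by
    rw [← intervalIntegral.integral_comp_sub_right (fun y => ramp (j - M * y)) (1 / M : ℝ), softMin]
    refine intervalIntegral.integral_congr fun y _ => congrArg ramp ?_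
    push_cast
    field_simp
    ring
  have h1 := intervalIntegral.integral_add_adjacent_intervals
    (intervalIntegrable_ramp M j (0 - 1 / M) (x - 1 / M)) (intervalIntegrable_ramp M j (x - 1 / M) x)
  have h2 := intervalIntegral.integral_add_adjacent_intervals
    (intervalIntegrable_ramp M j (0 - 1 / M) 0) (intervalIntegrable_ramp M j 0 x)
  have h3 : 0 ≤ ∫ y in (x - 1 / M : ℝ)..x, ramp (j - M * y) :=
    intervalIntegral.integral_nonneg (by simp) fun y _ => ramp_nonneg _
  have h4 := intervalIntegral.integral_mono_on (a := (0 - 1 / M : ℝ)) (b := 0) (by simp)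
    (intervalIntegrable_ramp M j _ _) (continuous_const.intervalIntegrable (μ := volume) _ _)
    fun y _ => ramp_le_one (j - M * y)
  rw [intervalIntegral.integral_const, smul_eq_mul, mul_one] at h4
  rw [hshift]
  unfold softMin
  linarith

/-- One factor of each square is at most `1 / M`; the other telescopes to `x`. -/
lemma sum_softMin_sq_le (hM : 0 < M) (hx : x ∈ Icc (0 : ℝ) 1) :
    ∑ j ∈ Finset.range (M + 1), (softMin M (j + 1) x - softMin M j x) ^ 2 ≤ 1 / M * x := by
  calc _ ≤ ∑ j ∈ Finset.range (M + 1), 1 / (M : ℝ) * (softMin M (j + 1) x - softMin M j x) := by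
        refine Finset.sum_le_sum fun j _ => ?_
        rw [sq]
        exact mul_le_mul_of_nonneg_right (softMin_succ_sub_le hM j x)
          (sub_nonneg.2 (softMin_le_succ M j hx.1))
    _ = _ := by
        rw [← Finset.mul_sum, Finset.sum_range_sub (fun j => softMin M j x), softMin_last hx,
          softMin_zero hx.1, sub_zero]

/-- The increment vanishes for `j ≥ M x + 1` and both slopes vanish for `j + 1 ≤ M x`, so only
boundedly many slices see the side of a tooth at height `x`. The count is made by `ramp (j + 2 - M
x) - ramp (j - 1 - M x)`, which equals `1` for the remaining indices and sums to at most `3`. -/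
lemma sum_softMin_sq_mul_ramp_le (hM : 0 < M) (hx : x ∈ Icc (0 : ℝ) 1) :
    ∑ j ∈ Finset.range (M + 1), (softMin M (j + 1) x - softMin M j x) ^ 2 *
      (ramp (j - M * x) + ramp ((j + 1 : ℕ) - M * x)) ≤ 6 * (1 / M) ^ 2 := by
  have hterm : ∀ j : ℕ, (softMin M (j + 1) x - softMin M j x) ^ 2 *
      (ramp (j - M * x) + ramp ((j + 1 : ℕ) - M * x)) ≤
      2 * (1 / M) ^ 2 * ((ramp ((j + 1 : ℕ) + 1 - M * x) - ramp (j + 1 - M * x)) +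
        ((ramp ((j + 1 : ℕ) - M * x) - ramp (j - M * x)) +
        (ramp ((j + 1 : ℕ) - 1 - M * x) - ramp (j - 1 - M * x)))) := by
    intro j
    have hr : (ramp ((j + 1 : ℕ) + 1 - M * x) - ramp (j + 1 - M * x)) +
        ((ramp ((j + 1 : ℕ) - M * x) - ramp (j - M * x)) +
        (ramp ((j + 1 : ℕ) - 1 - M * x) - ramp (j - 1 - M * x))) =
        ramp (j + 2 - M * x) - ramp (j - 1 - M * x) := by
      push_cast
      rw [show (j : ℝ) + 1 + 1 - M * x = j + 2 - M * x by ring,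
        show (j : ℝ) + 1 - 1 - M * x = j - M * x by ring]
      ring
    rw [hr]
    have hnn : 0 ≤ ramp (j + 2 - M * x) - ramp (j - 1 - M * x) :=
      sub_nonneg.2 (ramp_mono (by linarith))
    rcases le_or_gt (M * x + 1) j with h | h
    · rw [softMin_succ_eq hx.1 h]
      have : 0 ≤ 2 * (1 / (M : ℝ)) ^ 2 * (ramp (j + 2 - M * x) - ramp (j - 1 - M * x)) := by
        positivity
      simpa using this
    rcases le_or_gt ((j : ℝ) + 1) (M * x) with h' | h'
    · rw [ramp_of_nonpos (x := j - M * x) (by linarith),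
        ramp_of_nonpos (x := (j + 1 : ℕ) - M * x) (by push_cast; linarith)]
      simp only [add_zero, mul_zero]
      positivity
    · rw [ramp_of_one_le (x := j + 2 - M * x) (by linarith),
        ramp_of_nonpos (x := j - 1 - M * x) (by linarith)]
      have h1 : (softMin M (j + 1) x - softMin M j x) ^ 2 ≤ (1 / M) ^ 2 :=
        pow_le_pow_left₀ (sub_nonneg.2 (softMin_le_succ M j hx.1)) (softMin_succ_sub_le hM j x) 2
      have h2 := ramp_le_one (j - M * x)
      have h3 := ramp_le_one ((j + 1 : ℕ) - M * x)
      calc _ ≤ (1 / (M : ℝ)) ^ 2 * 2 :=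
            mul_le_mul h1 (by linarith) (add_nonneg (ramp_nonneg _) (ramp_nonneg _)) (by positivity)
        _ = _ := by ring
  refine (Finset.sum_le_sum fun j _ => hterm j).trans ?_
  rw [← Finset.mul_sum, Finset.sum_add_distrib, Finset.sum_add_distrib,
    Finset.sum_range_sub (fun j : ℕ => ramp (j + 1 - M * x)),
    Finset.sum_range_sub (fun j : ℕ => ramp (j - M * x)),
    Finset.sum_range_sub (fun j : ℕ => ramp (j - 1 - M * x))]
  have h : ∀ y z : ℝ, ramp y - ramp z ≤ 1 := fun y z => by
    linarith [ramp_le_one y, ramp_nonneg z]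
  calc _ ≤ 2 * (1 / (M : ℝ)) ^ 2 * (1 + (1 + 1)) := by
        gcongr <;> exact h _ _
    _ = _ := by ring

end softMin

/-! ### The cost of growing teeth. -/

/-- The periodic function `softMin M j ∘ m`. -/
def CircleLift.softMin (m : CircleLift 0) (M j : ℕ) : CircleLift 0 where
  toFun u := _root_.softMin M j (m u)
  der u := ramp (j - M * m u) * m.der u
  hasDerivAt u := (hasDerivAt_softMin M j (m u)).comp u (m.hasDerivAt u)
  continuous_der := by fun_prop
  shift u := by rw [m.shift, add_zero, add_zero]

lemma sum_sqrt_le (c : ℕ → ℝ) (hc : ∀ i, 0 ≤ c i) (n : ℕ) :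
    ∑ i ∈ Finset.range n, Real.sqrt (c i) ≤ Real.sqrt (n * ∑ i ∈ Finset.range n, c i) := by
  refine Real.le_sqrt_of_sq_le ?_
  have := sq_sum_le_card_mul_sum_sq (s := Finset.range n) (f := fun i => Real.sqrt (c i))
  simpa [Real.sq_sqrt, hc] using this

/-- The cost of growing the teeth `m b` in `M` steps, each of which moves only their tips. -/
lemma curveDist_wave_grow_step {σ b : C1Curve} (h : Transversal σ b) {φ : CircleLift 1}
    (hφ : ∀ u, 0 < φ.der u) {m : CircleLift 0} (hm : ∀ u, m u ∈ Icc (0 : ℝ) 1) {D : ℝ}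
    (hD : ∀ u, |m.der u| ≤ D) {M : ℕ} (hM : 0 < M) :
    curveDist (wave σ b φ 0) (wave σ b φ m) ≤ ENNReal.ofReal (Real.sqrt
      ((1 + 1 / M) * (‖b‖ ^ 2 * (2 * (‖σ‖ + ‖b‖) * (∫ u in (0 : ℝ)..1, m u * φ.der u) +
        ‖b‖ * D * 6 * (1 / M))))) := by
  have hM' : (0 : ℝ) < M := by exact_mod_cast hM
  have hmem : ∀ j u, m.softMin M j u ∈ Icc (0 : ℝ) 1 := fun j u => softMin_mem M j (hm u)
  have h0 : wave σ b φ (m.softMin M 0) = wave σ b φ 0 := C1Curve.ext_fn fun u => by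
    simp only [wave_fn, CircleLift.softMin, softMin_zero (hm u).1]
    rfl
  -- Truncation number `j` is exact only up to height `(j - 1) / M`, hence `M + 1` steps.
  have h1 : wave σ b φ (m.softMin M (M + 1)) = wave σ b φ m := C1Curve.ext_fn fun u => by
    simp only [wave_fn, CircleLift.softMin, softMin_last (hm u)]
  set F : ℕ → ℝ → ℝ := fun j u => ‖b‖ ^ 2 * ((m.softMin M (j + 1) u - m.softMin M j u) ^ 2 *
        (2 * (‖σ‖ + ‖b‖) * φ.der u + ‖b‖ * (|(m.softMin M j).der u| +
          |(m.softMin M (j + 1)).der u|))) with hF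
  have hFc : ∀ j, Continuous (F j) := fun j => by
    have hg := fun i => (m.softMin M i).continuous
    have hg' := fun i => (m.softMin M i).continuous_der
    have hφ' := φ.continuous_der
    exact continuous_const.mul ((((hg _).sub (hg _)).pow 2).mul
      ((continuous_const.mul hφ').add (continuous_const.mul ((hg' _).abs.add (hg' _).abs))))
  have hFn : ∀ j u, 0 ≤ F j u := fun j u => by
    have := (hφ u).le
    positivity
  have key := (curveDist_le_sum (fun j => wave σ b φ (m.softMin M j))
    (wave_mem_imm1 h hφ (hmem 0)) (M + 1)).trans (Finset.sum_le_sum fun j _ =>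
      curveDist_wave_step_le h hφ (hmem j) (hmem (j + 1)))
  rw [h0, h1] at key
  refine key.trans ?_
  rw [← ENNReal.ofReal_sum_of_nonneg fun _ _ => Real.sqrt_nonneg _]
  refine ENNReal.ofReal_le_ofReal ((sum_sqrt_le (fun j => ∫ u in (0 : ℝ)..1, F j u)
    (fun j => intervalIntegral.integral_nonneg zero_le_one fun u _ => hFn j u) (M + 1)).trans ?_)
  refine Real.sqrt_le_sqrt ?_
  rw [← intervalIntegral.integral_finsetSum fun j _ => (hFc j).intervalIntegrable _ _]
  have hbound : ∫ u in (0 : ℝ)..1, ∑ j ∈ Finset.range (M + 1), F j u ≤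
      ∫ u in (0 : ℝ)..1, ‖b‖ ^ 2 * (2 * (‖σ‖ + ‖b‖) * (1 / M) * (m u * φ.der u) +
        ‖b‖ * D * (6 * (1 / M) ^ 2)) := by
    refine intervalIntegral.integral_mono_on zero_le_one
      (Continuous.intervalIntegrable (by fun_prop) _ _)
      (Continuous.intervalIntegrable (by fun_prop) _ _) fun u _ => ?_
    have hD0 : 0 ≤ D := (abs_nonneg _).trans (hD u)
    have hsplit : ∀ j ∈ Finset.range (M + 1), F j u ≤
        ‖b‖ ^ 2 * (2 * (‖σ‖ + ‖b‖) * φ.der u * (softMin M (j + 1) (m u) - softMin M j (m u)) ^ 2 +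
        ‖b‖ * D * ((softMin M (j + 1) (m u) - softMin M j (m u)) ^ 2 *
          (ramp (j - M * m u) + ramp ((j + 1 : ℕ) - M * m u)))) := by
      intro j _
      have hder : ∀ i : ℕ, |(m.softMin M i).der u| ≤ ramp (i - M * m u) * D := fun i => by
        change |ramp (i - M * m u) * m.der u| ≤ _
        rw [abs_mul, abs_of_nonneg (ramp_nonneg _)]
        exact mul_le_mul_of_nonneg_left (hD u) (ramp_nonneg _)
      have hsum : |(m.softMin M j).der u| + |(m.softMin M (j + 1)).der u| ≤
          D * (ramp (j - M * m u) + ramp ((j + 1 : ℕ) - M * m u)) := by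
        linarith [hder j, hder (j + 1)]
      calc F j u ≤ ‖b‖ ^ 2 * ((softMin M (j + 1) (m u) - softMin M j (m u)) ^ 2 *
            (2 * (‖σ‖ + ‖b‖) * φ.der u + ‖b‖ *
              (D * (ramp (j - M * m u) + ramp ((j + 1 : ℕ) - M * m u))))) := by
            rw [hF]
            simp only
            change _ * ((softMin M (j + 1) (m u) - softMin M j (m u)) ^ 2 * _) ≤ _
            gcongr
        _ = _ := by ring
    refine (Finset.sum_le_sum hsplit).trans ?_
    rw [← Finset.mul_sum, Finset.sum_add_distrib, ← Finset.mul_sum, ← Finset.mul_sum]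
    have := (hφ u).le
    calc _ ≤ ‖b‖ ^ 2 * (2 * (‖σ‖ + ‖b‖) * φ.der u * (1 / M * m u) +
          ‖b‖ * D * (6 * (1 / M) ^ 2)) := by
          gcongr
          · exact sum_softMin_sq_le hM (hm u)
          · exact sum_softMin_sq_mul_ramp_le hM (hm u)
      _ = _ := by ring
  rw [intervalIntegral.integral_const_mul, intervalIntegral.integral_add
    (Continuous.intervalIntegrable (by fun_prop) _ _)
    (Continuous.intervalIntegrable (by fun_prop) _ _), intervalIntegral.integral_const_mul,
    intervalIntegral.integral_const, sub_zero, one_smul] at hbound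
  -- The factor `M + 1` from Cauchy–Schwarz turns `1 / M` into `1 + 1 / M`, while the slope term, of
  -- order `1 / M ^ 2`, still tends to zero.
  calc _ ≤ ((M + 1 : ℕ) : ℝ) * _ := mul_le_mul_of_nonneg_left hbound (Nat.cast_nonneg _)
    _ = _ := by
      generalize ‖b‖ = B, ‖σ‖ = S
      push_cast
      field_simp

/-- Growing teeth is cheap if the points that move carry little length. -/
lemma curveDist_wave_grow_le {σ b : C1Curve} (h : Transversal σ b) {φ : CircleLift 1}
    (hφ : ∀ u, 0 < φ.der u) {m : CircleLift 0} (hm : ∀ u, m u ∈ Icc (0 : ℝ) 1) {D : ℝ}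
    (hD : ∀ u, |m.der u| ≤ D) :
    curveDist (wave σ b φ 0) (wave σ b φ m) ≤ ENNReal.ofReal (Real.sqrt
      (‖b‖ ^ 2 * (2 * (‖σ‖ + ‖b‖) * ∫ u in (0 : ℝ)..1, m u * φ.der u))) := by
  have step := fun n : ℕ => curveDist_wave_grow_step h hφ hm hD n.succ_pos
  generalize curveDist (wave σ b φ 0) (wave σ b φ m) = d at step ⊢
  generalize ‖b‖ = B, ‖σ‖ = S at step ⊢
  generalize (∫ u in (0 : ℝ)..1, m u * φ.der u) = I at step ⊢
  -- With `x = 1 / M → 0` the term containing the slope bound `D` disappears.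
  have hcont : Continuous fun x : ℝ => ENNReal.ofReal (Real.sqrt
      ((1 + x) * (B ^ 2 * (2 * (S + B) * I + B * D * 6 * x)))) :=
    ENNReal.continuous_ofReal.comp (Real.continuous_sqrt.comp (by fun_prop))
  have := (hcont.tendsto 0).comp (tendsto_one_div_add_atTop_nhds_zero_nat (𝕜 := ℝ))
  simp only [mul_zero, add_zero, one_mul] at this
  exact ge_of_tendsto' this fun n => by simpa using step n

/-! ### Oscillating teeth and concentrated parametrizations. -/

namespace CircleLift

lemma der_add_one {d : ℝ} (f : CircleLift d) (u : ℝ) : f.der (u + 1) = f.der u := by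
  have h := ((f.hasDerivAt (u + 1)).comp_add_const u 1).sub_const d
  simp only [f.shift, add_sub_cancel_right] at h
  exact h.unique (f.hasDerivAt u)

lemma shift_nat {d : ℝ} (f : CircleLift d) (u : ℝ) (n : ℕ) : f (u + n) = f u + n * d := by
  induction n with
  | zero => simp
  | succ n ih =>
    push_cast
    rw [← add_assoc, f.shift, ih]
    ring

/-- The lift `u ↦ f ((n + 1) u) / (n + 1)` of degree one, which is close to the identity. -/
def compress (f : CircleLift 1) (n : ℕ) : CircleLift 1 where
  toFun u := f (((n + 1 : ℕ) : ℝ) * u) / (n + 1 : ℕ)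
  der u := f.der (((n + 1 : ℕ) : ℝ) * u)
  hasDerivAt u := by
    have h0 : ((n + 1 : ℕ) : ℝ) ≠ 0 := by positivity
    have := ((f.hasDerivAt (((n + 1 : ℕ) : ℝ) * u)).comp u
      ((_root_.hasDerivAt_id u).const_mul ((n + 1 : ℕ) : ℝ))).div_const ((n + 1 : ℕ) : ℝ)
    rwa [mul_one, mul_div_cancel_right₀ _ h0] at this
  continuous_der := by fun_prop
  shift u := by
    have h0 : ((n + 1 : ℕ) : ℝ) ≠ 0 := by positivity
    rw [mul_add, mul_one, f.shift_nat, mul_one, add_div, div_self h0]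

/-- The periodic function `u ↦ f ((n + 1) u)`. -/
def oscillate (f : CircleLift 0) (n : ℕ) : CircleLift 0 where
  toFun u := f (((n + 1 : ℕ) : ℝ) * u)
  der u := f.der (((n + 1 : ℕ) : ℝ) * u) * (n + 1 : ℕ)
  hasDerivAt u := by
    have := (f.hasDerivAt (((n + 1 : ℕ) : ℝ) * u)).comp u
      ((_root_.hasDerivAt_id u).const_mul ((n + 1 : ℕ) : ℝ))
    rwa [mul_one] at this
  continuous_der := by fun_prop
  shift u := by rw [mul_add, mul_one, f.shift_nat, mul_zero]

lemma abs_compress_sub_le {f : CircleLift 1} (hf : ∀ u, |f u - u| ≤ 1) (n : ℕ) (u : ℝ) :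
    |f.compress n u - u| ≤ 1 / (n + 1 : ℕ) := by
  have h0 : (0 : ℝ) < (n + 1 : ℕ) := by positivity
  have : f.compress n u - u = (f (((n + 1 : ℕ) : ℝ) * u) - ((n + 1 : ℕ) : ℝ) * u) / (n + 1 : ℕ) := by
    change f (((n + 1 : ℕ) : ℝ) * u) / (n + 1 : ℕ) - u = _
    field_simp
  rw [this, abs_div, abs_of_pos h0]
  exact div_le_div_of_nonneg_right (hf _) h0.le

lemma integral_comp_mul_nat {F : ℝ → ℝ} (hc : Continuous F) (hp : Function.Periodic F 1) (n : ℕ) :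
    ∫ u in (0 : ℝ)..1, F (((n + 1 : ℕ) : ℝ) * u) = ∫ u in (0 : ℝ)..1, F u := by
  have h0 : ((n + 1 : ℕ) : ℝ) ≠ 0 := by positivity
  have h := hp.intervalIntegral_add_zsmul_eq (n + 1 : ℕ) 0 fun _ _ => hc.intervalIntegrable _ _
  rw [intervalIntegral.integral_comp_mul_left F h0, mul_zero, mul_one]
  simp only [zero_add, zsmul_eq_mul, mul_one, Int.cast_natCast] at h
  rw [h, smul_eq_mul, inv_mul_cancel_left₀ h0]

lemma integral_oscillate_mul_compress (m : CircleLift 0) (f : CircleLift 1) (n : ℕ) :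
    ∫ u in (0 : ℝ)..1, m.oscillate n u * (f.compress n).der u =
      ∫ u in (0 : ℝ)..1, m u * f.der u :=
  integral_comp_mul_nat (F := fun u => m u * f.der u) (by fun_prop)
    (fun u => by simp only [m.shift, f.der_add_one, add_zero]) n

lemma oneSub_oscillate (f : CircleLift 0) (n : ℕ) :
    f.oneSub.oscillate n = (f.oscillate n).oneSub := by
  simp [oneSub, oscillate, neg_mul]

/-- The primitive of a periodic function of mean one. -/
def primitive (w : ℝ → ℝ) (hc : Continuous w) (hp : Function.Periodic w 1)
    (h1 : ∫ u in (0 : ℝ)..1, w u = 1) : CircleLift 1 where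
  toFun u := ∫ x in (0 : ℝ)..u, w x
  der := w
  hasDerivAt u := intervalIntegral.integral_hasDerivAt_right (hc.intervalIntegrable _ _)
    (hc.stronglyMeasurableAtFilter _ _) hc.continuousAt
  continuous_der := hc
  shift u := by
    rw [← intervalIntegral.integral_add_adjacent_intervals (hc.intervalIntegrable 0 u)
      (hc.intervalIntegrable u (u + 1)), hp.intervalIntegral_add_eq u 0, zero_add, h1]

lemma abs_primitive_sub_le {w : ℝ → ℝ} (hc : Continuous w) (hp : Function.Periodic w 1)
    (h1 : ∫ u in (0 : ℝ)..1, w u = 1) (hw : ∀ u, 0 < w u) (u : ℝ) :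
    |primitive w hc hp h1 u - u| ≤ 1 := by
  set P := primitive w hc hp h1
  have hper : Function.Periodic (fun u => P u - u) 1 := fun u => by
    simp only [P.shift]
    ring
  obtain ⟨v, hv, huv⟩ := hper.exists_mem_Ico₀ zero_lt_one u
  rw [show P u - u = P v - v from huv]
  have h2 : 0 ≤ P v := intervalIntegral.integral_nonneg hv.1 fun x _ => (hw x).le
  have h3 : P v ≤ 1 := by
    have h4 := intervalIntegral.integral_add_adjacent_intervals
      (hc.intervalIntegrable (μ := volume) 0 v) (hc.intervalIntegrable v 1)
    rw [h1] at h4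
    exact (le_add_of_nonneg_right
      (intervalIntegral.integral_nonneg hv.2.le fun x _ => (hw x).le)).trans_eq h4
  rw [abs_le]
  constructor <;> linarith [hv.1, hv.2]

/-- The periodic function `sin² (π u)`. -/
def sinSq : CircleLift 0 where
  toFun u := Real.sin (Real.pi * u) ^ 2
  der u := 2 * Real.sin (Real.pi * u) * (Real.cos (Real.pi * u) * Real.pi)
  hasDerivAt u := by
    have := ((Real.hasDerivAt_sin (Real.pi * u)).comp u
      ((_root_.hasDerivAt_id u).const_mul Real.pi)).pow 2
    simp only [mul_one, Nat.cast_ofNat, Nat.add_one_sub_one, pow_one] at this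
    exact this
  continuous_der := by fun_prop
  shift u := by rw [mul_add, mul_one, Real.sin_add_pi]; ring

lemma sinSq_mem (u : ℝ) : sinSq u ∈ Icc (0 : ℝ) 1 := ⟨sq_nonneg _, Real.sin_sq_le_one _⟩

lemma sinSq_le (u : ℝ) : sinSq u ≤ Real.pi ^ 2 * u ^ 2 := by
  rw [← mul_pow]
  exact sq_le_sq.2 Real.abs_sin_le_abs

lemma abs_der_sinSq_le (u : ℝ) : |sinSq.der u| ≤ 2 * Real.pi := by
  change |2 * Real.sin (Real.pi * u) * (Real.cos (Real.pi * u) * Real.pi)| ≤ _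
  rw [abs_mul, abs_mul, abs_mul, abs_two, abs_of_pos Real.pi_pos]
  have h1 := Real.abs_sin_le_one (Real.pi * u)
  have h2 := Real.abs_cos_le_one (Real.pi * u)
  have h3 := Real.pi_pos
  calc _ ≤ 2 * 1 * (1 * Real.pi) := by gcongr
    _ = _ := by ring

lemma sinSq_add_half (u : ℝ) : sinSq (u + 1 / 2) = sinSq.oneSub u := by
  change Real.sin (Real.pi * (u + 1 / 2)) ^ 2 = 1 - Real.sin (Real.pi * u) ^ 2
  rw [mul_add, mul_one_div, Real.sin_add_pi_div_two, Real.cos_sq']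

lemma oneSub_mem {f : CircleLift 0} (hf : ∀ u, f u ∈ Icc (0 : ℝ) 1) (u : ℝ) :
    f.oneSub u ∈ Icc (0 : ℝ) 1 :=
  ⟨sub_nonneg.2 (hf u).2, sub_le_self _ (hf u).1⟩

/-- A weight of mean one that concentrates near the zeros of `sinSq`. -/
lemma exists_weight_sinSq {δ : ℝ} (hδ : 0 < δ) : ∃ w : ℝ → ℝ, Continuous w ∧
    Function.Periodic w 1 ∧ (∀ u, 0 < w u) ∧ ∫ u in (0 : ℝ)..1, w u = 1 ∧
    ∫ u in (0 : ℝ)..1, sinSq u * w u ≤ δ := by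
  have hK : 0 < 1 + Real.pi ^ 2 := by positivity
  obtain ⟨ε, hε, hε1, hεδ⟩ : ∃ ε : ℝ, 0 < ε ∧ ε ≤ 1 ∧ ε * (1 + Real.pi ^ 2) ≤ δ :=
    ⟨min 1 (δ / (1 + Real.pi ^ 2)), by positivity, min_le_left _ _,
      (le_div_iff₀ hK).1 (min_le_right _ _)⟩
  -- `W` has mass of order at least `1 / ε` near the zeros of `sinSq`, while `sinSq * W ≤ 1`
  -- everywhere; after normalization the integral is `O(ε)`.
  set W : ℝ → ℝ := fun u => (ε ^ 2 + sinSq u)⁻¹ with hW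
  have hden : ∀ u, 0 < ε ^ 2 + sinSq u := fun u => by
    have := (sinSq_mem u).1
    positivity
  have hWpos : ∀ u, 0 < W u := fun u => inv_pos.2 (hden u)
  have hWc : Continuous W := Continuous.inv₀ (by fun_prop) fun u => (hden u).ne'
  set Z := ∫ u in (0 : ℝ)..1, W u with hZ
  have hZle : (ε * (1 + Real.pi ^ 2))⁻¹ ≤ Z := by
    -- On `[0, ε]` the denominator is at most `ε ^ 2 (1 + π ^ 2)`.
    have h1 : ∫ u in (0 : ℝ)..ε, (ε ^ 2 * (1 + Real.pi ^ 2))⁻¹ ≤ ∫ u in (0 : ℝ)..ε, W u := by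
      refine intervalIntegral.integral_mono_on hε.le (by simp) (hWc.intervalIntegrable _ _)
        fun u hu => inv_anti₀ (hden u) ?_
      have := sinSq_le u
      have h2 : u ^ 2 ≤ ε ^ 2 := pow_le_pow_left₀ hu.1 hu.2 2
      have h3 := mul_le_mul_of_nonneg_left h2 (sq_nonneg Real.pi)
      linarith
    have h2 : 0 ≤ ∫ u in ε..1, W u :=
      intervalIntegral.integral_nonneg hε1 fun u _ => (hWpos u).le
    have h3 := intervalIntegral.integral_add_adjacent_intervals (hWc.intervalIntegrable (μ := volume) 0 ε)
      (hWc.intervalIntegrable (μ := volume) ε 1)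
    rw [intervalIntegral.integral_const, sub_zero, smul_eq_mul] at h1
    have h4 : ε * (ε ^ 2 * (1 + Real.pi ^ 2))⁻¹ = (ε * (1 + Real.pi ^ 2))⁻¹ := by
      field_simp
    linarith
  have hZpos : 0 < Z := lt_of_lt_of_le (by positivity) hZle
  have hI : ∫ u in (0 : ℝ)..1, sinSq u * W u ≤ 1 := by
    have := intervalIntegral.integral_mono_on zero_le_one (f := fun u => sinSq u * W u)
      (g := fun _ => (1 : ℝ)) (μ := volume) (Continuous.intervalIntegrable (by fun_prop) 0 1)
      (continuous_const.intervalIntegrable 0 1) fun u _ => by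
        rw [hW, ← div_eq_mul_inv, div_le_one (hden u)]
        exact le_add_of_nonneg_left (sq_nonneg ε)
    simpa using this
  refine ⟨fun u => Z⁻¹ * W u, by fun_prop, fun u => ?_, fun u => by have := hWpos u; positivity,
    ?_, ?_⟩
  · simp only [hW, sinSq.shift, add_zero]
  · rw [intervalIntegral.integral_const_mul, inv_mul_cancel₀ hZpos.ne']
  · simp only [mul_left_comm _ Z⁻¹]
    rw [intervalIntegral.integral_const_mul]
    have : Z⁻¹ ≤ ε * (1 + Real.pi ^ 2) := inv_le_of_inv_le₀ (by positivity) hZle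
    calc _ ≤ Z⁻¹ * 1 := mul_le_mul_of_nonneg_left hI (by positivity)
      _ ≤ δ := by linarith

lemma exists_lift_sinSq {δ : ℝ} (hδ : 0 < δ) : ∃ P : CircleLift 1, (∀ u, 0 < P.der u) ∧
    (∀ u, |P u - u| ≤ 1) ∧ ∫ u in (0 : ℝ)..1, sinSq u * P.der u ≤ δ := by
  obtain ⟨w, hc, hp, hw, h1, h2⟩ := exists_weight_sinSq hδ
  exact ⟨primitive w hc hp h1, hw, abs_primitive_sub_le hc hp h1 hw, h2⟩

/-- A half-period translation exchanges `sin²` and `1 - sin²`, so the previous weight is translated.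
-/
lemma exists_lift_oneSub_sinSq {δ : ℝ} (hδ : 0 < δ) : ∃ P : CircleLift 1, (∀ u, 0 < P.der u) ∧
    (∀ u, |P u - u| ≤ 1) ∧ ∫ u in (0 : ℝ)..1, sinSq.oneSub u * P.der u ≤ δ := by
  obtain ⟨w, hc, hp, hw, h1, h2⟩ := exists_weight_sinSq hδ
  have hshift : ∀ F : ℝ → ℝ, Function.Periodic F 1 →
      ∫ u in (0 : ℝ)..1, F (u + 1 / 2) = ∫ u in (0 : ℝ)..1, F u := fun F hF => by
    have := hF.intervalIntegral_add_eq (1 / 2) 0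
    rw [intervalIntegral.integral_comp_add_right F, zero_add, add_comm 1 (1 / 2 : ℝ), this, zero_add]
  have h1' : ∫ u in (0 : ℝ)..1, w (u + 1 / 2) = 1 := (hshift w hp).trans h1
  have hp' : Function.Periodic (fun u => w (u + 1 / 2)) 1 := fun u => by
    simp only [add_right_comm u 1, hp _]
  have hc' : Continuous fun u => w (u + 1 / 2) := by fun_prop
  refine ⟨primitive _ hc' hp' h1', fun u => hw _,
    abs_primitive_sub_le hc' hp' h1' fun u => hw _, ?_⟩
  have h3 := hshift (fun u => sinSq u * w u) fun u => by simp only [sinSq.shift, add_zero, hp u]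
  simp only [sinSq_add_half] at h3
  exact h3.trans_le h2

end CircleLift

open CircleLift

/-! ### Transversal displacements cost nothing. -/

/-- The cost of growing many teeth on a curve. -/
lemma curveDist_wave_oscillate_le {σ b : C1Curve} (h : Transversal σ b) {P : CircleLift 1}
    (hP : ∀ u, 0 < P.der u) (hP1 : ∀ u, |P u - u| ≤ 1) {m : CircleLift 0}
    (hm : ∀ u, m u ∈ Icc (0 : ℝ) 1) {D : ℝ} (hD : ∀ u, |m.der u| ≤ D) {δ : ℝ}
    (hδ : ∫ u in (0 : ℝ)..1, m u * P.der u ≤ δ) (n : ℕ) :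
    curveDist σ (wave σ b (P.compress n) (m.oscillate n)) ≤
      ENNReal.ofReal ((‖σ‖ + ‖b‖) * (1 / (n + 1 : ℕ)) * Real.sqrt (2 * (‖σ‖ + ‖b‖))) +
      ENNReal.ofReal (Real.sqrt (‖b‖ ^ 2 * (2 * (‖σ‖ + ‖b‖) * δ))) := by
  have hder : ∀ u, 0 < (P.compress n).der u := fun u => hP _
  have hzero : ∀ u, (0 : CircleLift 0) u ∈ Icc (0 : ℝ) 1 := fun _ => ⟨le_rfl, zero_le_one⟩
  have h1 := curveDist_wave_reparam_le h (φ := CircleLift.id) (ψ := P.compress n)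
    (fun _ => zero_lt_one) hder hzero (D := 0) (abs_compress_sub_le hP1 n)
    (fun u => abs_zero.le)
  rw [wave_id_zero, mul_zero, add_zero] at h1
  have h2 := curveDist_wave_grow_le h hder (m := m.oscillate n) (fun u => hm _)
    (D := D * (n + 1 : ℕ)) fun u => by
      change |m.der _ * ((n + 1 : ℕ) : ℝ)| ≤ _
      rw [abs_mul, Nat.abs_cast]
      exact mul_le_mul_of_nonneg_right (hD _) (Nat.cast_nonneg _)
  rw [integral_oscillate_mul_compress] at h2
  refine (curveDist_triangle _ (wave σ b (P.compress n) 0) _).trans (add_le_add h1 (h2.trans ?_))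
  gcongr

/-- The five terms are the costs of reparametrizing `σ`, growing the teeth, sliding the toothed
curve from one parametrization to the other, and the first two again from `σ + b`. -/
lemma curveDist_add_le {σ b : C1Curve} (h : Transversal σ b) {δ : ℝ} (hδ : 0 < δ) (n : ℕ) :
    curveDist σ (σ + b) ≤
      ENNReal.ofReal ((‖σ‖ + ‖b‖) * (1 / (n + 1 : ℕ)) * Real.sqrt (2 * (‖σ‖ + ‖b‖))) +
      ENNReal.ofReal (Real.sqrt (‖b‖ ^ 2 * (2 * (‖σ‖ + ‖b‖) * δ))) +
      (ENNReal.ofReal ((‖σ‖ + ‖b‖) * (2 * (1 / (n + 1 : ℕ))) *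
        Real.sqrt (2 * ((‖σ‖ + ‖b‖) + ‖b‖ * (2 * Real.pi * (n + 1 : ℕ))))) +
      (ENNReal.ofReal
        ((‖σ + b‖ + ‖-b‖) * (1 / (n + 1 : ℕ)) * Real.sqrt (2 * (‖σ + b‖ + ‖-b‖))) +
      ENNReal.ofReal (Real.sqrt (‖-b‖ ^ 2 * (2 * (‖σ + b‖ + ‖-b‖) * δ))))) := by
  obtain ⟨P, hP, hP1, hPδ⟩ := exists_lift_sinSq hδ
  obtain ⟨Q, hQ, hQ1, hQδ⟩ := exists_lift_oneSub_sinSq hδ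
  have h1 := curveDist_wave_oscillate_le h hP hP1 sinSq_mem abs_der_sinSq_le hPδ n
  have h3 := curveDist_wave_oscillate_le h.flip hQ hQ1 (oneSub_mem sinSq_mem)
    (fun u => (abs_neg (sinSq.der u)).trans_le (abs_der_sinSq_le u)) hQδ n
  have e : wave (σ + b) (-b) (Q.compress n) (sinSq.oneSub.oscillate n) =
      wave σ b (Q.compress n) (sinSq.oscillate n) := by
    rw [oneSub_oscillate]
    exact wave_flip σ b (Q.compress n) (sinSq.oscillate n)
  rw [e, curveDist_comm] at h3
  have h2 := curveDist_wave_reparam_le h (φ := P.compress n) (ψ := Q.compress n)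
    (fun u => hP _) (fun u => hQ _) (g := sinSq.oscillate n) (fun u => sinSq_mem _)
    -- Both parametrizations are within `1 / (n + 1)` of the identity, and oscillation multiplies
    -- the slope by `n + 1`.
    (ρ := 2 * (1 / (n + 1 : ℕ))) (D := 2 * Real.pi * (n + 1 : ℕ))
    (fun u => by
      have h4 := abs_compress_sub_le hP1 n u
      have h5 := abs_compress_sub_le hQ1 n u
      have := abs_sub_le (Q.compress n u) u (P.compress n u)
      rw [abs_sub_comm u] at this
      linarith)
    (fun u => by
      change |sinSq.der _ * ((n + 1 : ℕ) : ℝ)| ≤ _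
      rw [abs_mul, Nat.abs_cast]
      exact mul_le_mul_of_nonneg_right (abs_der_sinSq_le _) (Nat.cast_nonneg _))
  exact (curveDist_triangle _ (wave σ b (P.compress n) (sinSq.oscillate n)) _).trans
    (add_le_add h1 ((curveDist_triangle _ (wave σ b (Q.compress n) (sinSq.oscillate n)) _).trans
      (add_le_add h2 h3)))

/-- Adding a transversal displacement to a curve does not move it in the Riemannian distance. -/
theorem curveDist_add_eq_zero {σ b : C1Curve} (h : Transversal σ b) :
    curveDist σ (σ + b) = 0 := by
  have hle := fun (δ : ℝ) (hδ : 0 < δ) n => curveDist_add_le h hδ n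
  generalize curveDist σ (σ + b) = d at hle ⊢
  generalize ‖σ + b‖ + ‖-b‖ = A' at hle
  generalize ‖-b‖ = B' at hle
  generalize ‖σ‖ + ‖b‖ = A at hle
  generalize ‖b‖ = B at hle
  have hlim : ∀ δ : ℝ, 0 < δ → d ≤ ENNReal.ofReal (Real.sqrt (B ^ 2 * (2 * A * δ))) +
      ENNReal.ofReal (Real.sqrt (B' ^ 2 * (2 * A' * δ))) := by
    intro δ hδ
    have hcont : Continuous fun x : ℝ => ENNReal.ofReal (A * x * Real.sqrt (2 * A)) +
        ENNReal.ofReal (Real.sqrt (B ^ 2 * (2 * A * δ))) +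
        (ENNReal.ofReal (A * (2 * Real.sqrt (2 * (A * x ^ 2 + B * (2 * Real.pi * x))))) +
        (ENNReal.ofReal (A' * x * Real.sqrt (2 * A')) +
        ENNReal.ofReal (Real.sqrt (B' ^ 2 * (2 * A' * δ))))) := by
      refine ((ENNReal.continuous_ofReal.comp (by fun_prop)).add continuous_const).add
        ((ENNReal.continuous_ofReal.comp (by fun_prop)).add
          ((ENNReal.continuous_ofReal.comp (by fun_prop)).add continuous_const))
    have := (hcont.tendsto 0).comp (tendsto_one_div_add_atTop_nhds_zero_nat (𝕜 := ℝ))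
    simp only [mul_zero, zero_mul, ENNReal.ofReal_zero, zero_add, add_zero, Real.sqrt_zero,
      ne_eq, OfNat.ofNat_ne_zero, not_false_eq_true, zero_pow] at this
    refine ge_of_tendsto' this fun n => (hle δ hδ n).trans (le_of_eq ?_)
    have hn : (0 : ℝ) < (n : ℝ) + 1 := by positivity
    -- Moving `1 / (n + 1)` under the root shows that the sliding cost tends to zero although the
    -- length grows like `n`.
    have e : 1 / ((n : ℝ) + 1) * Real.sqrt (2 * (A + B * (2 * Real.pi * (n + 1)))) =
        Real.sqrt (2 * (A * (1 / ((n : ℝ) + 1)) ^ 2 + B * (2 * Real.pi * (1 / (n + 1))))) := by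
      rw [← Real.sqrt_sq (show 0 ≤ 1 / ((n : ℝ) + 1) by positivity), ← Real.sqrt_mul (sq_nonneg _),
        Real.sqrt_sq (show 0 ≤ 1 / ((n : ℝ) + 1) by positivity)]
      congr 1
      field_simp
    simp only [Function.comp_apply, Nat.cast_add, Nat.cast_one, ← e]
    ring_nf
  have hcont : Continuous fun δ : ℝ => ENNReal.ofReal (Real.sqrt (B ^ 2 * (2 * A * δ))) +
      ENNReal.ofReal (Real.sqrt (B' ^ 2 * (2 * A' * δ))) :=
    (ENNReal.continuous_ofReal.comp (by fun_prop)).add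
      (ENNReal.continuous_ofReal.comp (by fun_prop))
  have := (hcont.tendsto 0).comp (tendsto_one_div_add_atTop_nhds_zero_nat (𝕜 := ℝ))
  simp only [mul_zero, Real.sqrt_zero, ENNReal.ofReal_zero, add_zero] at this
  exact le_antisymm (ge_of_tendsto' this fun n => hlim _ (by positivity)) bot_le

/-! ### Rotation and a field oblique to the tangent. -/

/-- The rotation of the plane by a right angle. -/
def rotate : Plane →L[ℝ] Plane :=
  LinearMap.toContinuousLinearMap
    { toFun := fun x => !₂[-x 1, x 0]
      map_add' := fun x y => by ext i; fin_cases i <;> simp [add_comm]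
      map_smul' := fun c x => by ext i; fin_cases i <;> simp }

lemma rotate_apply (x : Plane) : rotate x = !₂[-x 1, x 0] := rfl

lemma inner_rotate_right (x : Plane) : inner ℝ x (rotate x) = 0 := by
  simp [rotate_apply, PiLp.inner_apply, Fin.sum_univ_two]
  ring

lemma norm_rotate (x : Plane) : ‖rotate x‖ = ‖x‖ := by
  simp [rotate_apply, EuclideanSpace.norm_eq, Fin.sum_univ_two, add_comm]

lemma rotate_rotate (x : Plane) : rotate (rotate x) = -x := by
  ext i
  fin_cases i <;> simp [rotate_apply]

namespace C1Curve

/-- The curve `γ` rotated by a right angle. -/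
def rot (γ : C1Curve) : C1Curve :=
  ofPeriodic (fun u => rotate (γ.fn u)) (fun u => rotate (γ.dfn u))
    (fun u => rotate.hasFDerivAt.comp_hasDerivAt u (γ.hasDerivAt_fn u)) (by fun_prop)
    fun u => by rw [γ.fn_add_one]

lemma fn_rot (γ : C1Curve) (u : ℝ) : γ.rot.fn u = rotate (γ.fn u) := rfl

/-- The pointwise inner product of two curves. -/
def inner (γ η : C1Curve) : CircleLift 0 where
  toFun u := Inner.inner ℝ (γ.fn u) (η.fn u)
  der u := Inner.inner ℝ (γ.fn u) (η.dfn u) + Inner.inner ℝ (γ.dfn u) (η.fn u)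
  hasDerivAt u := (γ.hasDerivAt_fn u).inner ℝ (η.hasDerivAt_fn u)
  continuous_der := by fun_prop
  shift u := by rw [γ.fn_add_one, η.fn_add_one, add_zero]

lemma abs_inner_le (γ η : C1Curve) (u : ℝ) : |γ.inner η u| ≤ ‖γ‖ * ‖η‖ :=
  (abs_real_inner_le_norm _ _).trans
    (mul_le_mul (γ.norm_fn_le u) (η.norm_fn_le u) (norm_nonneg _) (norm_nonneg _))

lemma abs_der_inner_le (γ η : C1Curve) (u : ℝ) : |(γ.inner η).der u| ≤ 2 * (‖γ‖ * ‖η‖) := by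
  refine (abs_add_le _ _).trans ?_
  have h1 := (abs_real_inner_le_norm (γ.fn u) (η.dfn u)).trans
    (mul_le_mul (γ.norm_fn_le u) (η.norm_dfn_le u) (norm_nonneg _) (norm_nonneg _))
  have h2 := (abs_real_inner_le_norm (γ.dfn u) (η.fn u)).trans
    (mul_le_mul (γ.norm_dfn_le u) (η.norm_fn_le u) (norm_nonneg _) (norm_nonneg _))
  linarith

/-- The product of a curve with a scalar function. -/
def mulFun (g : CircleLift 0) (γ : C1Curve) : C1Curve :=
  ofPeriodic (fun u => g u • γ.fn u) (fun u => g u • γ.dfn u + g.der u • γ.fn u)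
    (fun u => (g.hasDerivAt u).smul (γ.hasDerivAt_fn u)) (by fun_prop)
    (fun u => by rw [g.shift, γ.fn_add_one, add_zero])

lemma fn_mulFun (g : CircleLift 0) (γ : C1Curve) (u : ℝ) :
    (mulFun g γ).fn u = g u • γ.fn u := rfl

lemma norm_mulFun_le {g : CircleLift 0} {C : ℝ} (hC : 0 ≤ C) (h0 : ∀ u, |g u| ≤ C)
    (h1 : ∀ u, |g.der u| ≤ 2 * C) (γ : C1Curve) : ‖mulFun g γ‖ ≤ 3 * C * ‖γ‖ := by
  have hn := norm_nonneg γ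
  refine norm_le_of_forall (by positivity) (fun u => ?_) (fun u => ?_)
  · rw [fn_mulFun, norm_smul, Real.norm_eq_abs]
    have := mul_le_mul (h0 u) (γ.norm_fn_le u) (norm_nonneg _) hC
    have := mul_nonneg hC hn
    linarith
  · refine (norm_add_le _ _).trans ?_
    rw [norm_smul, norm_smul, Real.norm_eq_abs, Real.norm_eq_abs]
    have := mul_le_mul (h0 u) (γ.norm_dfn_le u) (norm_nonneg _) hC
    have := mul_le_mul (h1 u) (γ.norm_fn_le u) (norm_nonneg _) (by positivity)
    linarith

/-- The difference quotient `(γ (u + h) - γ u) / h`. -/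
def diffQuot (γ : C1Curve) (h : ℝ) : C1Curve :=
  ofPeriodic (fun u => h⁻¹ • (γ.fn (u + h) - γ.fn u)) (fun u => h⁻¹ • (γ.dfn (u + h) - γ.dfn u))
    (fun u => (((γ.hasDerivAt_fn (u + h)).comp_add_const u h).sub
      (γ.hasDerivAt_fn u)).const_smul h⁻¹) (by fun_prop)
    fun u => by rw [add_right_comm, γ.fn_add_one, γ.fn_add_one]

lemma uniformContinuous_dfn (γ : C1Curve) : UniformContinuous γ.dfn :=
  (CompactSpace.uniformContinuous_of_continuous γ.derivative.continuous).comp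
    (uniformContinuous_of_continuousAt_zero (QuotientAddGroup.mk' (AddSubgroup.zmultiples (1 : ℝ)))
      (AddCircle.continuous_mk' 1).continuousAt)

/-- The derivative of a curve is uniformly approximated by curves of class `C¹`. -/
lemma exists_approx_dfn (γ : C1Curve) {ε : ℝ} (hε : 0 < ε) :
    ∃ τ : C1Curve, ∀ u, ‖τ.fn u - γ.dfn u‖ ≤ ε := by
  obtain ⟨δ, hδ, h⟩ := Metric.uniformContinuous_iff.1 γ.uniformContinuous_dfn ε hε
  have hh : 0 < δ / 2 := by positivity
  refine ⟨γ.diffQuot (δ / 2), fun u => ?_⟩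
  -- Mean value inequality for `γ x - x γ' u`, whose derivative is at most `ε` on this window.
  have key := (convex_Icc u (u + δ / 2)).norm_image_sub_le_of_norm_hasDerivWithin_le
    (f := fun x => γ.fn x - x • γ.dfn u) (f' := fun x => γ.dfn x - (1 : ℝ) • γ.dfn u) (C := ε)
    (x := u) (y := u + δ / 2)
    (fun x _ => ((γ.hasDerivAt_fn x).sub
      ((hasDerivAt_id x).smul_const (γ.dfn u))).hasDerivWithinAt)
    (fun x hx => by
      rw [one_smul, ← dist_eq_norm]
      refine (h ?_).le
      rw [Real.dist_eq, abs_lt]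
      constructor <;> linarith [hx.1, hx.2])
    ⟨le_rfl, by linarith⟩ ⟨by linarith, le_rfl⟩
  have e : (γ.diffQuot (δ / 2)).fn u - γ.dfn u = (δ / 2)⁻¹ •
      (γ.fn (u + δ / 2) - (u + δ / 2) • γ.dfn u - (γ.fn u - u • γ.dfn u)) := by
    change (δ / 2)⁻¹ • (γ.fn (u + δ / 2) - γ.fn u) - γ.dfn u = _
    match_scalars <;> field_simp
    ring
  rw [e, norm_smul, Real.norm_of_nonneg (by positivity), inv_mul_le_iff₀ hh, mul_comm]
  rwa [add_sub_cancel_left, Real.norm_of_nonneg hh.le] at key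

lemma exists_pos_le_norm_dfn {γ : C1Curve} (h : γ ∈ Imm1) : ∃ κ > 0, ∀ u, κ ≤ ‖γ.dfn u‖ := by
  obtain ⟨x, -, hx⟩ := isCompact_univ.exists_isMinOn (univ_nonempty (α := UnitAddCircle))
    γ.derivative.continuous.norm.continuousOn
  exact ⟨‖γ.derivative x‖, norm_pos_iff.2 (h x), fun u => hx (mem_univ (u : UnitAddCircle))⟩

/-- There is a field `e` of class `C¹` such that the tangent of `γ` is nowhere orthogonal to `e`
or to `e` rotated by a right angle. -/
lemma exists_oblique_field {γ : C1Curve} (h : γ ∈ Imm1) : ∃ e : C1Curve, ∃ κ > 0, ∀ u,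
    κ ≤ |Inner.inner ℝ (γ.dfn u) (e.fn u)| ∧ κ ≤ |Inner.inner ℝ (γ.dfn u) (e.rot.fn u)| := by
  obtain ⟨κ, hκ, hle⟩ := exists_pos_le_norm_dfn h
  obtain ⟨τ, hτ⟩ := γ.exists_approx_dfn (show 0 < κ / 4 by positivity)
  -- `γ'` is only continuous, so `τ` stands in for it. The field `τ + τ.rot` makes nearly half a
  -- right angle with the tangent, and both inner products are close to `± ‖γ'‖ ^ 2`.
  refine ⟨τ + τ.rot, κ * (κ / 2), by positivity, fun u => ?_⟩
  set x := γ.dfn u with hx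
  set y := τ.fn u - x with hy
  have hy' : τ.fn u = x + y := by rw [hy]; abel
  have hxy : |Inner.inner ℝ x y| ≤ ‖x‖ * (κ / 4) :=
    (abs_real_inner_le_norm x y).trans (mul_le_mul_of_nonneg_left (hτ u) (norm_nonneg x))
  have hxr : |Inner.inner ℝ x (rotate y)| ≤ ‖x‖ * (κ / 4) :=
    (abs_real_inner_le_norm x _).trans (by
      rw [norm_rotate]
      exact mul_le_mul_of_nonneg_left (hτ u) (norm_nonneg x))
  have hbig : κ * (κ / 2) ≤ ‖x‖ ^ 2 - ‖x‖ * (κ / 2) := by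
    have : 0 ≤ (‖x‖ - κ) * (‖x‖ + κ / 2) :=
      mul_nonneg (sub_nonneg.2 (hle u)) (by positivity)
    nlinarith
  rw [abs_le] at hxy hxr
  constructor
  · rw [fn_add, fn_rot, hy', map_add]
    simp only [inner_add_right, real_inner_self_eq_norm_sq, inner_rotate_right]
    exact le_trans (by linarith [hxy.1, hxr.1]) (le_abs_self _)
  · rw [fn_rot, fn_add, fn_rot, hy', map_add, rotate_rotate, map_add]
    simp only [inner_add_right, inner_neg_right, real_inner_self_eq_norm_sq, inner_rotate_right]
    exact le_trans (by linarith [hxy.2, hxr.2]) (neg_le_abs _)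

end C1Curve

open C1Curve

/-! ### Local vanishing and the conclusion. -/

/-- Pairing with `f` kills every multiple of `b`, and `g b'` is too small to cancel the pairing of
`σ'` with `f`. -/
lemma transversal_of_inner_eq_zero {σ b f : C1Curve} (h0 : ∀ u, inner ℝ (b.fn u) (f.fn u) = 0)
    (h1 : ∀ u, ‖b‖ * ‖f‖ < |inner ℝ (σ.dfn u) (f.fn u)|) : Transversal σ b := by
  intro u g hg l hz
  have h2 := congrArg (fun x => inner ℝ x (f.fn u)) hz
  simp only [inner_add_left, real_inner_smul_left, h0, mul_zero, add_zero, inner_zero_left] at h2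
  have h3 : inner ℝ (σ.dfn u) (f.fn u) = -(g * inner ℝ (b.dfn u) (f.fn u)) := by linarith
  have h4 : |inner ℝ (b.dfn u) (f.fn u)| ≤ ‖b‖ * ‖f‖ := (abs_real_inner_le_norm _ _).trans
    (mul_le_mul (b.norm_dfn_le u) (f.norm_fn_le u) (norm_nonneg _) (norm_nonneg _))
  have h5 := h1 u
  rw [h3, abs_neg, abs_mul, abs_of_nonneg hg.1] at h5
  exact absurd (h5.trans_le (mul_le_of_le_one_left (abs_nonneg _) hg.2)) (not_lt.2 h4)

/-- The Riemannian distance vanishes locally. -/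
lemma exists_ball_curveDist_eq_zero {γ : C1Curve} (h : γ ∈ Imm1) :
    ∃ δ > 0, ∀ η ∈ Metric.ball γ δ, curveDist γ η = 0 := by
  obtain ⟨e, κ, hκ, he⟩ := exists_oblique_field h
  have he0 : ∀ u, e.inner e u ≠ 0 := fun u hu => by
    have h1 := (he u).1
    rw [inner_self_eq_zero.1 hu, inner_zero_right, abs_zero] at h1
    linarith
  set r : CircleLift 0 :=
    { toFun := fun u => (e.inner e u)⁻¹
      der := fun u => -(e.inner e).der u / e.inner e u ^ 2
      hasDerivAt := fun u => ((e.inner e).hasDerivAt u).inv (he0 u)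
      continuous_der := Continuous.div (by fun_prop) (by fun_prop) fun u => pow_ne_zero 2 (he0 u)
      shift := fun u => by rw [(e.inner e).shift, add_zero, add_zero] } with hr
  set K := 3 * ‖e‖ * ‖mulFun r e‖ with hK
  have hK0 : 0 ≤ K := by positivity
  -- `1 + 2 K` bounds `‖c - b‖ + ‖b‖` relative to `‖c‖`; the added `1` makes `B` positive.
  set B := (1 + 2 * K) * (‖e‖ + ‖e.rot‖) + 1 with hB
  have hB0 : 0 < B := by positivity
  refine ⟨κ / B, by positivity, fun η hη => ?_⟩
  obtain ⟨c, rfl⟩ : ∃ c, η = γ + c := ⟨η - γ, (add_sub_cancel γ η).symm⟩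
  rw [Metric.mem_ball, dist_eq_norm, add_sub_cancel_left, lt_div_iff₀ hB0] at hη
  -- The pointwise orthogonal projection of `c` onto `e`: transversality of `b` is tested against
  -- `e.rot`, that of `c - b` against `e`.
  set b := mulFun (c.inner e) (mulFun r e) with hb
  have hbK : ‖b‖ ≤ K * ‖c‖ := (norm_mulFun_le (by positivity) (c.abs_inner_le e)
    (c.abs_der_inner_le e) _).trans_eq (by rw [hK]; ring)
  have hbfn : ∀ u, b.fn u = (inner ℝ (c.fn u) (e.fn u) * (inner ℝ (e.fn u) (e.fn u))⁻¹) • e.fn u :=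
    fun u => smul_smul _ _ _
  have hcb : ‖c - b‖ ≤ (1 + K) * ‖c‖ := (norm_sub_le c b).trans (by linarith)
  have hc0 := norm_nonneg c
  have he1 := norm_nonneg e
  have he2 := norm_nonneg e.rot
  have hsmall : (1 + 2 * K) * ‖c‖ * (‖e‖ + ‖e.rot‖) < κ := by
    rw [hB] at hη
    linarith
  have h1 : Transversal γ b := by
    refine transversal_of_inner_eq_zero (f := e.rot) (fun u => ?_) fun u =>
      lt_of_lt_of_le ?_ (he u).2
    · rw [hbfn, fn_rot, real_inner_smul_left, inner_rotate_right, mul_zero]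
    · refine lt_of_le_of_lt ?_ hsmall
      gcongr
      · nlinarith
      · linarith
  have h2 : Transversal (γ + b) (c - b) := by
    refine transversal_of_inner_eq_zero (f := e) (fun u => ?_) fun u => ?_
    · have : inner ℝ (e.fn u) (e.fn u) ≠ 0 := he0 u
      rw [fn_sub, hbfn, inner_sub_left, real_inner_smul_left, inv_mul_cancel_right₀ this, sub_self]
    · rw [dfn_add, inner_add_left]
      have h3 : |inner ℝ (b.dfn u) (e.fn u)| ≤ ‖b‖ * ‖e‖ := (abs_real_inner_le_norm _ _).trans
        (mul_le_mul (b.norm_dfn_le u) (e.norm_fn_le u) (norm_nonneg _) (norm_nonneg _))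
      have h4 := abs_sub_abs_le_abs_add (inner ℝ (γ.dfn u) (e.fn u)) (inner ℝ (b.dfn u) (e.fn u))
      have h5 : ‖c - b‖ * ‖e‖ + ‖b‖ * ‖e‖ ≤ (1 + 2 * K) * ‖c‖ * (‖e‖ + ‖e.rot‖) := by
        calc _ = (‖c - b‖ + ‖b‖) * ‖e‖ := by ring
          _ ≤ _ := by
            gcongr
            · linarith
            · linarith
      linarith [(he u).1]
  have h3 := curveDist_triangle γ (γ + b) (γ + b + (c - b))
  rw [curveDist_add_eq_zero h1, curveDist_add_eq_zero h2, add_assoc γ, add_sub_cancel] at h3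
  simpa using h3

theorem mainTheorem5 (γ₀ γ₁ : Imm1) (h : γ₁ ∈ pathComponent γ₀) :
    l2dsDist γ₀ γ₁ = 0 := by
  have hloc : ∀ γ : Imm1, ∃ δ > 0, ∀ η ∈ Metric.ball γ δ, l2dsDist γ η = 0 := fun γ => by
    obtain ⟨δ, hδ, hball⟩ := exists_ball_curveDist_eq_zero γ.2
    exact ⟨δ, hδ, fun η hη => (curveDist_coe γ η).symm.trans (hball η hη)⟩
  -- A ball around a curve at distance zero stays at distance zero; conversely, if the ball around
  -- `γ` meets the set, symmetry and the triangle inequality put `γ` in it.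
  have hclopen : IsClopen {γ : Imm1 | l2dsDist γ₀ γ = 0} := by
    constructor
    · rw [← isOpen_compl_iff, Metric.isOpen_iff]
      intro γ hγ
      obtain ⟨δ, hδ, hball⟩ := hloc γ
      refine ⟨δ, hδ, fun η hη hη0 => hγ (le_antisymm ?_ bot_le)⟩
      refine (l2dsDist_triangle γ₀ η γ).trans ?_
      rw [show l2dsDist γ₀ η = 0 from hη0, zero_add]
      exact (l2dsDist_comm_le γ η).trans (hball η hη).le
    · rw [Metric.isOpen_iff]
      intro γ hγ
      obtain ⟨δ, hδ, hball⟩ := hloc γ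
      refine ⟨δ, hδ, fun η hη => le_antisymm ?_ bot_le⟩
      refine (l2dsDist_triangle γ₀ γ η).trans ?_
      rw [show l2dsDist γ₀ γ = 0 from hγ, zero_add]
      exact (hball η hη).le
  have h0 : γ₀ ∈ {γ : Imm1 | l2dsDist γ₀ γ = 0} := by
    change l2dsDist γ₀ γ₀ = 0
    rw [← curveDist_coe, curveDist_self γ₀.2]
  exact hclopen.connectedComponent_subset h0 (pathComponent_subset_component γ₀ h)

end
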